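/- For $n,\ell\ge 1$ and tuple weights $w=(w_{i,j})_{1\le i\le \ell,\,1\le j\le n}$ in $\mathbb R$, let $G_{n,\ell}(w)$ be the weighted DAG of the Cartesian product of $\ell$ relations with $n$ tuples each: a source $s$, $\ell$ stages of $n$ nodes (one node per tuple) and a target $t$, where every node has an edge to every node of the next stage ($s$ stands before the first stage, $t$ after the last), an edge to the $j$-th node of stage $i$ has weight $w_{i,j}$, and the edges to $t$ have weight $0$. A solution is an $s$–$t$ path; its weight is the sum of its edge weights. Ranked enumeration returns all solutions explicitly, without repetition, in ascending order of weight. Time is counted in elementary RAM steps (comparing or adding two weights, and every memory access, takes one step); the time-to-last is the time until all solutions have been returned. The algorithm anyK-rec first runs standard dynamic programming. This gives, for every node $v$, the weight of a shortest path from $v$ to $t$ (a shortest suffix of $v$) and a priority queue $\mathrm{Choices}(v)$ with the shortest suffix of $v$ through each of its successors. Every node also keeps a sorted list of its suffixes found so far. The next suffix of $v$ is read from the sorted list if it is there; otherwise it is popped from $\mathrm{Choices}(v)$, appended to the list, and, if it consists of $v$ followed by the $k'$-th suffix of $v'$, replaced in the queue by $v$ followed by the $(k'+1)$-st suffix of $v'$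 (if it exists), which is obtained by a recursive call. The algorithm repeatedly asks for the next suffix of $s$, and writes it out node by node, until $\mathrm{Choices}(s)$ is empty. The priority queues are heaps with linear-time construction and logarithmic-time insertion and removal of a minimum. A Batch algorithm first writes out all $N=n^\ell$ solutions in some order, without regard to the weights, and then sorts them by weight with a general-purpose comparison sort, i.e. any comparison-based (decision-tree) algorithm that sorts $N$ items correctly for all choices of real keys. Its time is bounded below by the number of nodes written plus the number of comparisons made; $T_{\mathrm{Batch}}$ denotes this number. Since a general-purpose sort does not know how its input is arranged, $T_{\mathrm{Batch}}$ on a given weighted DAG is taken in the mean (hence the lower bounds also hold in the worst case) over all $N!$ orders in which the solutions may be listed before they are sorted. There are constants $C,c>0$, independent of $n$, $\ell$, the weights and the Batch algorithm, such that the following holds. 1. For all $n,\ell\ge1$ and all weights $w$, anyK-rec solves the ranked enumeration problem on $G_{n,\ell}(w)$ and terminates in time at most $C\,n^\ell(\log n+\ell)$; in particular its time-to-last is $O(n^\ell(\log n+\ell))$. 2. For all $n,\ell\ge 1$, $G_{n,\ell}(w)$ has $n^\ell$ solutions, and there are weights $w$ for which the solutions have pairwise distinct weights. 3. For all $n,\ell\ge1$,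 all $w$ for which the solutions of $G_{n,\ell}(w)$ have pairwise distinct weights, and every general-purpose comparison sort used by Batch, $T_{\mathrm{Batch}}\ge c\,n^\ell\,\ell\log n$ on $G_{n,\ell}(w)$ (in the mean over the orders of the unsorted solutions). 4. Also for every Batch algorithm with a fixed order of enumeration on $G_{n,\ell}(w)$, $n,\ell\ge1$, there is a ranking of the solutions by pairwise distinct real numbers for which Batch needs at least $c\,n^\ell\,\ell\log n$ steps. 5. Consequently, anyK-rec has asymptotically lower time-to-last than any Batch algorithm on these inputs: for every $\varepsilon>0$ there is $m$ such that for all $n,\ell\ge m$, all $w$ for which the solutions of $G_{n,\ell}(w)$ have pairwise distinct weights, and every general-purpose comparison sort used by Batch, the time of anyK-rec on $G_{n,\ell}(w)$ is at most $\varepsilon\,T_{\mathrm{Batch}}$ (in the mean over the orders of the unsorted solutions) on the same input. -/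

import Mathlib

/-! ### Step counting -/

/-- A result together with the number of elementary RAM steps spent on computing it. -/
structure Timed (α : Type) where
  val : α
  steps : ℕ

instance : Monad Timed where
  pure a := ⟨a, 0⟩
  bind x f := ⟨(f x.val).val, x.steps + (f x.val).steps⟩

namespace Timed

/-- One elementary step. It pays for the bounded amount of control flow (entering a function,
inspecting a constructor, testing two nodes for equality, incrementing a counter, allocating a
cell) that is done at the place where it is charged. -/
def tick : Timed Unit := ⟨(), 1⟩

/-- Comparing two weights takes one step. -/
def le {W : Type} [LinearOrder W] (x y : W) : Timed Bool := ⟨decide (x ≤ y), 1⟩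

/-- Adding two weights takes one step. -/
def add {W : Type} [Add W] (x y : W) : Timed W := ⟨x + y, 1⟩

end Timed

/-! ### Weighted DAGs, their solutions, and ranked enumeration -/

/-- A weighted DAG with source and target, given by adjacency lists. `nodes` lists the nodes in a
reverse topological order: whenever `a` stands before `b`, there is no edge from `a` to `b`. -/
structure WeightedDAG (V W : Type) where
  source : V
  target : V
  nodes : List V
  succ : V → List V
  weight : V → V → W
  mem_nodes : ∀ v, v ∈ nodes
  nodes_nodup : nodes.Nodup
  succ_nodup : ∀ v, (succ v).Nodup
  succ_target : succ target = []
  not_mem_succ_self : ∀ v, v ∉ succ v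
  reverse_topological : nodes.Pairwise (fun a b => b ∉ succ a)

namespace WeightedDAG

variable {V W : Type}

/-- `p` is (the list of the nodes of) a path from the source to the target. -/
def IsSolution (G : WeightedDAG V W) (p : List V) : Prop :=
  p.head? = some G.source ∧ p.getLast? = some G.target ∧ p.IsChain (fun u v => v ∈ G.succ u)

/-- The solutions of the DP problem: all source-target paths. -/
def Solution (G : WeightedDAG V W) : Type := {p : List V // G.IsSolution p}

/-- The weight of a path: the sum of the weights of its edges. -/
def pathWeight [AddCommMonoid W] (G : WeightedDAG V W) : List V → W
  | u :: v :: p => G.weight u v + pathWeight G (v :: p)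
  | _ => 0

/-- `L` lists all source-target paths, explicitly, without repetition and by increasing weight. -/
def IsRankedEnumeration [AddCommMonoid W] [LinearOrder W] (G : WeightedDAG V W)
    (L : List (List V)) : Prop :=
  L.Nodup ∧ (∀ p, p ∈ L ↔ G.IsSolution p) ∧ L.Pairwise (fun p q => G.pathWeight p ≤ G.pathWeight q)

end WeightedDAG

/-! ### Priority queues: leftist heaps -/

/-- The suffix `v ∘ Π_{rank+1}(child)` of a node `v`, with its total weight. Ranks count from 0. -/
structure Suffix (V W : Type) where
  child : V
  rank : ℕ
  weight : W

/-- Binary trees; `npl` is the length of the right spine. -/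
inductive Heap (α : Type) where
  | nil : Heap α
  | node (npl : ℕ) (x : α) (l r : Heap α) : Heap α

namespace Heap

variable {V W : Type} [LinearOrder W]

def npl {α : Type} : Heap α → ℕ
  | nil => 0
  | node k _ _ _ => k

def size {α : Type} : Heap α → ℕ
  | nil => 0
  | node _ _ l r => l.size + r.size + 1

def isEmpty {α : Type} : Heap α → Bool
  | nil => true
  | node _ _ _ _ => false

/-- Put two heaps below `x`, the one with the shorter right spine on the right. -/
def make {α : Type} (x : α) (a b : Heap α) : Heap α :=
  if b.npl ≤ a.npl then node (b.npl + 1) x a b else node (a.npl + 1) x b a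

/-- Merging two leftist heaps along their right spines. -/
def merge : Heap (Suffix V W) → Heap (Suffix V W) → Timed (Heap (Suffix V W))
  | nil, h => do
    Timed.tick
    pure h
  | node k x l r, nil => do
    Timed.tick
    pure (node k x l r)
  | node k x l r, node k' y l' r' => do
    Timed.tick
    if ← Timed.le x.weight y.weight then
      let m ← merge r (node k' y l' r')
      pure (make x l m)
    else
      let m ← merge (node k x l r) r'
      pure (make y l' m)
termination_by h h' => h.size + h'.size
decreasing_by all_goals simp only [size]; omega

/-- Insertion of an element. -/
def add (x : Suffix V W) (h : Heap (Suffix V W)) : Timed (Heap (Suffix V W)) :=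
  merge (node 1 x nil nil) h

/-- Removal of an element of minimum weight. -/
def popMin : Heap (Suffix V W) → Timed (Option (Suffix V W × Heap (Suffix V W)))
  | nil => do
    Timed.tick
    pure none
  | node _ x l r => do
    Timed.tick
    let h ← merge l r
    pure (some (x, h))

/-- The heap of the first `m` elements of a list, and the rest of the list. -/
def buildAux : ℕ → List (Suffix V W) → Timed (Heap (Suffix V W) × List (Suffix V W))
  | 0, xs => do
    Timed.tick
    pure (nil, xs)
  | 1, [] => do
    Timed.tick
    pure (nil, [])
  | 1, x :: xs => do
    Timed.tick
    pure (node 1 x nil nil, xs)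
  | m + 2, xs => do
    Timed.tick
    let (a, ys) ← buildAux ((m + 2) / 2) xs
    let (b, zs) ← buildAux (m + 2 - (m + 2) / 2) ys
    let h ← merge a b
    pure (h, zs)
termination_by m _ => m

/-- Linear-time construction of a heap from a list (whose length the caller has counted). -/
def build (xs : List (Suffix V W)) : Timed (Heap (Suffix V W)) := do
  let (h, _) ← buildAux xs.length xs
  pure h

end Heap

/-! ### The algorithm anyK-rec -/

namespace AnyKRec

variable {V W : Type}

/-- What the algorithm stores at the nodes: the weight `best v` of a shortest suffix (`none` if
there is no suffix), the priority queue `Choices(v)`, and the sorted list (a dynamic array) of the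
suffixes of `v` found so far. -/
structure Memory (V W : Type) where
  best : V → Option W
  choices : V → Heap (Suffix V W)
  sorted : V → Array (Suffix V W)

/-- Programs with access to the memory, and with step counting. -/
abbrev Program (V W : Type) (α : Type) := StateT (Memory V W) Timed α

def tick : Program V W Unit := fun M => ⟨((), M), 1⟩

/-- Memory accesses, each of which takes one step. -/
def readBest (v : V) : Program V W (Option W) := fun M => ⟨(M.best v, M), 1⟩

def readChoices (v : V) : Program V W (Heap (Suffix V W)) := fun M => ⟨(M.choices v, M), 1⟩

/-- The `k`-th suffix in the sorted list of `v`, counted from 0, if it is there already. -/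
def readSorted (v : V) (k : ℕ) : Program V W (Option (Suffix V W)) :=
  fun M => ⟨((M.sorted v)[k]?, M), 1⟩

def readSortedSize (v : V) : Program V W ℕ := fun M => ⟨((M.sorted v).size, M), 1⟩

variable [DecidableEq V]

def writeBest (v : V) (x : W) : Program V W Unit :=
  fun M => ⟨((), { M with best := Function.update M.best v (some x) }), 1⟩

def writeChoices (v : V) (h : Heap (Suffix V W)) : Program V W Unit :=
  fun M => ⟨((), { M with choices := Function.update M.choices v h }), 1⟩

def pushSorted (v : V) (e : Suffix V W) : Program V W Unit :=
  fun M => ⟨((), { M with sorted := Function.update M.sorted v ((M.sorted v).push e) }), 1⟩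

variable [AddCommMonoid W] [LinearOrder W]

/-- The initial choices `v ∘ Π_1(u)` of a node `v`, for `u` in a list of successors of `v`. -/
def initialChoices (G : WeightedDAG V W) (v : V) : List V → Program V W (List (Suffix V W))
  | [] => do
    tick
    pure []
  | u :: us => do
    tick
    let b ← readBest u
    let rest ← initialChoices G v us
    match b with
    | none => pure rest
    | some x =>
      let y ← (Timed.add (G.weight v u) x : Timed W)
      pure (⟨u, 0, y⟩ :: rest)

/-- Standard DP at one node all of whose successors have been processed. -/
def dpNode (G : WeightedDAG V W) (v : V) : Program V W Unit := do
  tick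
  if v = G.target then
    writeBest v 0
  else
    let xs ← initialChoices G v (G.succ v)
    let h ← (Heap.build xs : Timed _)
    writeChoices v h
    match h with
    | .nil => pure ()
    | .node _ e _ _ => writeBest v e.weight

/-- Standard DP along a list of nodes. -/
def dp (G : WeightedDAG V W) : List V → Program V W Unit
  | [] => tick
  | v :: vs => do
    tick
    dpNode G v
    dp G vs

/-- Pop the best choice of `v` (if there is one), append it to the sorted list of `v`, and replace
it in the queue by the next suffix through the same child, which is obtained by calling `nxt`. -/
def advance (G : WeightedDAG V W) (nxt : V → ℕ → Program V W (Option (Suffix V W))) (v : V) :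
    Program V W Unit := do
  tick
  let h ← readChoices v
  let r ← (Heap.popMin h : Timed _)
  match r with
  | none => pure ()
  | some (e, h') =>
    writeChoices v h'
    pushSorted v e
    let o ← nxt e.child (e.rank + 1)
    match o with
    | none => pure ()
    | some e' =>
      let y ← (Timed.add (G.weight v e.child) e'.weight : Timed W)
      let h ← readChoices v
      let h' ← (Heap.add ⟨e.child, e.rank + 1, y⟩ h : Timed _)
      writeChoices v h'

/-- `next _ v k` returns the `k`-th suffix of `v`, counted from 0, i.e. the successor of the `k`-th
best suffix in the order of the suffixes of `v`; the result is `none` if there is no such suffix.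
A suffix that is in the sorted list of `v` already is only looked up. At the first visit of `v` the
shortest suffix, which DP has left at the top of the queue, is moved to the sorted list.
The first argument bounds the depth of the recursion. -/
def next (G : WeightedDAG V W) : ℕ → V → ℕ → Program V W (Option (Suffix V W))
  | 0, _, _ => do
    tick
    pure none
  | d + 1, v, k => do
    tick
    if v = G.target then
      pure none
    else
      let m ← readSortedSize v
      if m = 0 then
        advance G (next G d) v
      let m ← readSortedSize v
      if m ≤ k then
        advance G (next G d) v
      readSorted v k

/-- Write out the path to which the `k`-th suffix of `v` points, node by node. The first argument
bounds the number of nodes. -/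
def assemble (G : WeightedDAG V W) : ℕ → V → ℕ → Program V W (List V)
  | 0, _, _ => do
    tick
    pure []
  | d + 1, v, k => do
    tick
    if v = G.target then
      pure [v]
    else
      let o ← readSorted v k
      match o with
      | none => pure []
      | some e =>
        let p ← assemble G d e.child e.rank
        pure (v :: p)

/-- The main loop: `r` more iterations, unless the queue of the source gets empty before; `k`
solutions have been returned so far. A recursion depth equal to the number of nodes is no
restriction, since the graph is acyclic. -/
def loop (G : WeightedDAG V W) : ℕ → ℕ → Program V W (List (List V))
  | 0, _ => do
    tick
    pure []
  | r + 1, k => do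
    tick
    let h ← readChoices G.source
    if h.isEmpty then
      pure []
    else
      let _ ← next G G.nodes.length G.source k
      let p ← assemble G G.nodes.length G.source k
      let ps ← loop G r (k + 1)
      pure (p :: ps)

end AnyKRec

/-- The algorithm anyK-rec, interrupted after `k` solutions: the list of the solutions in the order
in which they are returned, and the number of steps, including the preprocessing. -/
def anyKRec {V W : Type} [DecidableEq V] [AddCommMonoid W] [LinearOrder W]
    (G : WeightedDAG V W) (k : ℕ) : Timed (List (List V)) := do
  let (ps, _) ← (do AnyKRec.dp G G.nodes; AnyKRec.loop G k 0 : AnyKRec.Program V W _).run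
    ⟨fun _ => none, fun _ => .nil, fun _ => #[]⟩
  pure ps

/-! ### Batch algorithms -/

/-- Comparison-based algorithms that arrange `N` items: decision trees that ask whether the key of
item `i` is at most the key of item `j`, and that end with an arrangement of the items. -/
inductive ComparisonTree (N : ℕ) where
  | output (σ : Equiv.Perm (Fin N)) : ComparisonTree N
  | compare (i j : Fin N) (yes no : ComparisonTree N) : ComparisonTree N

namespace ComparisonTree

variable {N : ℕ} {W : Type} [LinearOrder W]

/-- The arrangement that is computed for given keys. -/
def eval (key : Fin N → W) : ComparisonTree N → Equiv.Perm (Fin N)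
  | output σ => σ
  | compare i j yes no => if key i ≤ key j then eval key yes else eval key no

/-- The number of comparisons made for given keys. -/
def comparisons (key : Fin N → W) : ComparisonTree N → ℕ
  | output _ => 0
  | compare i j yes no =>
    (if key i ≤ key j then comparisons key yes else comparisons key no) + 1

end ComparisonTree

/-- General-purpose comparison sorts of `N` items: correct for all keys. -/
structure ComparisonSort (N : ℕ) where
  tree : ComparisonTree N
  sorts : ∀ key : Fin N → ℝ, Monotone (key ∘ tree.eval key)

/-- The time of the Batch algorithm that first writes out all solutions, node by node and in the
order `enum`, and then sorts them by `rank` with the comparison sort `A`. Only the nodes written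
and the comparisons are counted, so that this is a lower bound for the time of an implementation. -/
noncomputable def batchTime {V W : Type} {G : WeightedDAG V W} {N : ℕ} (enum : Fin N ≃ G.Solution)
    (A : ComparisonSort N) (rank : G.Solution → ℝ) : ℕ :=
  (∑ i, (enum i).val.length) + A.tree.comparisons (fun i => rank (enum i))

/-- The mean time of Batch if the solutions are listed in a random order before they are sorted:
all `N!` rearrangements of an enumeration are equally likely. -/
noncomputable def meanBatchTime {V W : Type} {G : WeightedDAG V W} {N : ℕ}
    (enum : Fin N ≃ G.Solution) (A : ComparisonSort N) (rank : G.Solution → ℝ) : ℝ :=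
  (∑ σ : Equiv.Perm (Fin N), (batchTime (σ.trans enum) A rank : ℝ)) / (N.factorial : ℝ)

/-! ### Fully connected multi-stage DAGs of Cartesian products -/

/-- The nodes: the `j`-th tuple of the `i`-th relation, and the source and the target. -/
inductive CPNode (n ℓ : ℕ) where
  | source : CPNode n ℓ
  | tuple (i : Fin ℓ) (j : Fin n) : CPNode n ℓ
  | target : CPNode n ℓ
  deriving DecidableEq

namespace CPNode

variable {n ℓ : ℕ}

/-- The nodes of stage `i` (relations are numbered from 0), where the last stage is the target. -/
def stage (n ℓ i : ℕ) : List (CPNode n ℓ) :=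
  if h : i < ℓ then (List.finRange n).map (tuple ⟨i, h⟩) else [target]

/-- Every node has an edge to every node of the next stage. -/
def succ : CPNode n ℓ → List (CPNode n ℓ)
  | source => stage n ℓ 0
  | tuple i _ => stage n ℓ (i + 1)
  | target => []

/-- The weight of an edge is the weight of the tuple to which it leads, and 0 at the target. -/
def weight {W : Type} [Zero W] (w : Fin ℓ → Fin n → W) (_u v : CPNode n ℓ) : W :=
  match v with
  | tuple i j => w i j
  | _ => 0

/-- All nodes, stage by stage, beginning with the target. -/
def nodes (n ℓ : ℕ) : List (CPNode n ℓ) :=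
  target :: ((List.finRange ℓ).reverse.flatMap fun i => (List.finRange n).map (tuple i)) ++ [source]

end CPNode

theorem CPNode.source_not_mem_succ {n ℓ : ℕ} (v : CPNode n ℓ) : source ∉ v.succ := by
  cases v <;> simp only [succ, stage] <;> (try split) <;> simp

theorem CPNode.tuple_mem_succ_tuple {n ℓ : ℕ} {i i' : Fin ℓ} {j j' : Fin n}
    (h : tuple i' j' ∈ (tuple i j).succ) : i < i' := by
  simp only [succ, stage] at h
  split at h
  · simp only [List.mem_map, List.mem_finRange, tuple.injEq, true_and] at h
    obtain ⟨_, rfl, _⟩ := h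
    simp [Fin.lt_def]
  · simp at h

/-- The multi-stage DAG of the Cartesian product of `ℓ` relations with `n` tuples each, where `w i j`
is the weight of the `j`-th tuple of the `i`-th relation. -/
def cartesianDAG {W : Type} [Zero W] (n ℓ : ℕ) (w : Fin ℓ → Fin n → W) :
    WeightedDAG (CPNode n ℓ) W where
  source := .source
  target := .target
  nodes := CPNode.nodes n ℓ
  succ := CPNode.succ
  weight := CPNode.weight w
  mem_nodes v := by cases v <;> simp [CPNode.nodes]
  nodes_nodup := by
    simp only [CPNode.nodes, List.cons_append, List.nodup_cons, List.nodup_append,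
      List.nodup_flatMap]
    refine ⟨by simp, ⟨?_, ?_⟩, by simp, ?_⟩
    rotate_right
    · simp only [List.mem_flatMap, List.mem_map, List.mem_singleton]
      rintro _ ⟨_, _, _, _, rfl⟩ _ rfl h
      cases h
    · intro i _
      exact (List.nodup_finRange n).map fun a b h => by simpa using h
    · have h : (List.finRange ℓ).reverse.Nodup := by simpa using List.nodup_finRange ℓ
      refine h.imp fun {a b} hab => ?_
      simp only [Function.onFun, List.disjoint_left, List.mem_map, not_exists, not_and]
      rintro _ ⟨j, _, rfl⟩ j' _ h'
      exact hab (CPNode.tuple.inj h').1.symm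
  succ_nodup v := by
    have h (i : ℕ) : (CPNode.stage n ℓ i).Nodup := by
      unfold CPNode.stage
      split
      · exact (List.nodup_finRange n).map fun a b h => by simpa using h
      · simp
    cases v <;> simp [CPNode.succ, h]
  succ_target := rfl
  not_mem_succ_self v h := by
    cases v with
    | source => exact CPNode.source_not_mem_succ _ h
    | tuple i j => exact lt_irrefl _ (CPNode.tuple_mem_succ_tuple h)
    | target => simp [CPNode.succ] at h
  reverse_topological := by
    simp only [CPNode.nodes, List.cons_append, List.pairwise_cons, List.pairwise_append,
      List.pairwise_flatMap]
    refine ⟨by simp [CPNode.succ], ⟨?_, ?_⟩, by simp, ?_⟩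
    · intro i _
      refine List.pairwise_map.2 (List.pairwise_of_forall fun a b h => ?_)
      exact lt_irrefl _ (CPNode.tuple_mem_succ_tuple h)
    · rw [List.pairwise_reverse]
      refine (List.pairwise_lt_finRange ℓ).imp fun {a b} hab => ?_
      simp only [List.mem_map]
      rintro _ ⟨j, _, rfl⟩ _ ⟨j', _, rfl⟩ h
      exact lt_asymm hab (CPNode.tuple_mem_succ_tuple h)
    · intro a _ b hb
      rw [List.mem_singleton.1 hb]
      exact CPNode.source_not_mem_succ a

/-! ### Lower bounds for comparison sorts -/

namespace ComparisonTree

variable {N : ℕ} {W : Type} [LinearOrder W]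

/-! Cost of anyK-rec. A single request to the source may recurse through all stages, but each level
of the recursion first moves a suffix to a sorted list, where it stays. Hence the total cost is
`O(log n)` per suffix ever found, plus `O(ℓ)` per solution for a bounded overhead and for writing it
out, plus the preprocessing. Each suffix is handled once per node and shared by all paths that use
it. A tuple node of stage `i` has `n ^ (ℓ - 1 - i)` suffixes, so stage `i` has `n ^ (ℓ - i)`. For `n
≥ 2` this geometric series is `O(n ^ ℓ)`; for `n = 1` it is `ℓ`, which the term `ℓ` of the bound
covers. The total is `O(n ^ ℓ (log n + ℓ))`.

Correctness rests on `NodeInv`: for each successor `u` of `v`, the sorted list of `v` holds exactly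
the first `c u` suffixes through `u`, the queue holds the next one if there is one, and nothing
listed is heavier than anything queued. `NodeInv.pop` shows that this survives one pop with its
replacement, because adding an edge weight is monotone. `advance_spec` and `next_spec` carry the
invariant and the amortised cost through the recursion, by induction on its depth. Once the list of
the source is full, `exists_points` finds every path in it, and `Points.rank_unique` excludes
repetitions.

Cost of Batch. A correct sort must answer differently on all `N!` rearrangements of distinct keys,
so by `card_mul_log_card_le_sum_comparisons` it makes at least `log N! ≥ N log N - N` comparisons in
the mean. The `N` or more nodes written make up for the loss. With `N = n ^ ℓ` this is `n ^ ℓ * ℓ *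
log n` with constant 1, and the quotient of the two times is at most `300 (1 / ℓ + 1 / log n)`,
which tends to 0. -/

theorem mul_log_add_le {a b : ℝ} (ha : 0 ≤ a) (hb : 0 ≤ b) :
    (a + b) * Real.log (a + b) ≤ (a + b) + (a * Real.log a + b * Real.log b) := by
  -- Convexity of `x log x` at the midpoint of `a` and `b` gives the bound with `(a + b) log 2` in
  -- place of `a + b`, and `log 2 ≤ 1`. The summand `a + b` will stand for the one comparison that
  -- each key makes at a vertex of the tree.
  have h := Real.convexOn_mul_log.2 (Set.mem_Ici.2 ha) (Set.mem_Ici.2 hb)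
    (show (0 : ℝ) ≤ 1 / 2 by norm_num) (show (0 : ℝ) ≤ 1 / 2 by norm_num) (by norm_num)
  simp only [smul_eq_mul] at h
  rcases (add_nonneg ha hb).eq_or_lt with h0 | h0
  · obtain rfl : a = 0 := by linarith
    obtain rfl : b = 0 := by linarith
    simp
  rw [show 1 / 2 * a + 1 / 2 * b = (a + b) / 2 by ring, Real.log_div h0.ne' two_ne_zero] at h
  nlinarith [Real.log_two_lt_d9]

/-- If a decision tree gives different answers for all members of a finite family of keys, then
the sum of the numbers of comparisons is at least that of a balanced tree. -/
theorem card_mul_log_card_le_sum_comparisons {ι : Type*} [DecidableEq ι] (T : ComparisonTree N)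
    (key : ι → Fin N → W) (S : Finset ι) (hS : Set.InjOn (fun s => T.eval (key s)) S) :
    (S.card : ℝ) * Real.log S.card ≤ ∑ s ∈ S, (T.comparisons (key s) : ℝ) := by
  induction T generalizing S with
  | output σ =>
    -- All keys get the same answer at a leaf, so at most one is left, and `x log x` vanishes at 0
    -- and 1.
    have : S.card ≤ 1 := Finset.card_le_one.2 fun a ha b hb => hS ha hb rfl
    interval_cases S.card <;> simp [comparisons]
  | compare i j yes no ih₁ ih₂ =>
    have h₁ := ih₁ (S.filter fun s => key s i ≤ key s j) fun a ha b hb h => by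
      simp only [Finset.coe_filter, Set.mem_ofPred_eq] at ha hb
      exact hS ha.1 hb.1 (by simpa [eval, ha.2, hb.2] using h)
    have h₂ := ih₂ (S.filter fun s => ¬ key s i ≤ key s j) fun a ha b hb h => by
      simp only [Finset.coe_filter, Set.mem_ofPred_eq] at ha hb
      exact hS ha.1 hb.1 (by simpa only [eval, if_neg ha.2, if_neg hb.2] using h)
    have hc := Finset.card_filter_add_card_filter_not (s := S) (fun s => key s i ≤ key s j)
    have h := mul_log_add_le
      (Nat.cast_nonneg (α := ℝ) (S.filter fun s => key s i ≤ key s j).card)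
      (Nat.cast_nonneg (α := ℝ) (S.filter fun s => ¬ key s i ≤ key s j).card)
    rw [← Nat.cast_add, hc] at h
    have hsum : ∑ s ∈ S, ((compare i j yes no).comparisons (key s) : ℝ) =
        S.card + (∑ s ∈ S with key s i ≤ key s j, (yes.comparisons (key s) : ℝ) +
          ∑ s ∈ S with ¬ key s i ≤ key s j, (no.comparisons (key s) : ℝ)) := by
      rw [Finset.sum_filter, Finset.sum_filter, ← Finset.sum_add_distrib, Finset.card_eq_sum_ones,
        Nat.cast_sum, ← Finset.sum_add_distrib]
      refine Finset.sum_congr rfl fun s _ => ?_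
      by_cases hs : key s i ≤ key s j <;> simp [comparisons, hs, add_comm]
    linarith

end ComparisonTree

/-- The term `N ^ N / N!` of the exponential series at `N` is at most `e ^ N`. -/
theorem mul_log_le_log_factorial_add (N : ℕ) :
    (N : ℝ) * Real.log N ≤ Real.log N.factorial + N := by
  rcases N.eq_zero_or_pos with rfl | hN
  · simp
  have h := Real.pow_div_factorial_le_exp (N : ℝ) (Nat.cast_nonneg N) N
  have hf : (0 : ℝ) < N.factorial := by exact_mod_cast N.factorial_pos
  have hN' : (0 : ℝ) < N := by exact_mod_cast hN
  have := Real.log_le_log (by positivity) h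
  rw [Real.log_div (by positivity) hf.ne', Real.log_pow, Real.log_exp] at this
  linarith

/-- The sorted sequence of keys does not depend on the initial order: it is the strictly increasing
sequence with the range of `key`. Hence the answer of the tree determines the permutation `σ` that
was fed in, and the tree separates all `N!` inputs. -/
theorem ComparisonSort.sum_comparisons_ge {N : ℕ} (A : ComparisonSort N) (key : Fin N → ℝ)
    (hkey : Function.Injective key) :
    (N.factorial : ℝ) * Real.log N.factorial ≤
      ∑ σ : Equiv.Perm (Fin N), (A.tree.comparisons (fun i => key (σ i)) : ℝ) := by
  have h := A.tree.card_mul_log_card_le_sum_comparisons (fun (σ : Equiv.Perm (Fin N)) i => key (σ i))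
    Finset.univ ?_
  · simpa [Fintype.card_perm] using h
  intro σ _ σ' _ hσ
  have hm (τ : Equiv.Perm (Fin N)) :
      StrictMono (key ∘ (τ ∘ A.tree.eval (fun i => key (τ i)))) :=
    Monotone.strictMono_of_injective (A.sorts fun i => key (τ i))
      (hkey.comp (τ.injective.comp (Equiv.injective _)))
  have hr (τ : Equiv.Perm (Fin N)) :
      Set.range (key ∘ (τ ∘ A.tree.eval (fun i => key (τ i)))) = Set.range key := by
    rw [Set.range_comp, (τ.surjective.comp (Equiv.surjective _)).range_eq, Set.image_univ]
  have heq := ((hm σ).range_inj (hm σ')).1 ((hr σ).trans (hr σ').symm)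
  ext i
  have := congrFun heq ((A.tree.eval fun i => key (σ i)).symm i)
  simp only at hσ
  simp only [Function.comp_apply, ← hσ, Equiv.apply_symm_apply] at this
  exact congrArg _ (hkey this)

/-! ### Lower bounds for Batch. -/

section

variable {V W : Type} {G : WeightedDAG V W} {N : ℕ}

theorem le_sum_length (enum : Fin N ≃ G.Solution) : N ≤ ∑ i, (enum i).val.length := by
  have : ∑ _i : Fin N, 1 ≤ ∑ i, (enum i).val.length := Finset.sum_le_sum fun i _ => by
    have h := (enum i).2.1
    rcases hp : (enum i).val with _ | _
    · simp [hp] at h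
    · simp
  simpa using this

/-- The summand `N` is the least possible number of nodes written. It cancels the error `N` in the
estimate of `log N!`, so that no constant is lost. -/
theorem ComparisonSort.mul_log_le_sum (A : ComparisonSort N)
    (key : Fin N → ℝ) (hkey : Function.Injective key) :
    (N.factorial : ℝ) * (N * Real.log N) ≤
      ∑ σ : Equiv.Perm (Fin N), ((N : ℝ) + A.tree.comparisons (fun i => key (σ i))) := by
  rw [Finset.sum_add_distrib]
  have h := A.sum_comparisons_ge key hkey
  have h' := mul_log_le_log_factorial_add N
  have hf : (0 : ℝ) < N.factorial := by exact_mod_cast N.factorial_pos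
  simp only [Finset.sum_const, Finset.card_univ, Fintype.card_perm, Fintype.card_fin, nsmul_eq_mul]
  nlinarith

theorem mul_log_le_meanBatchTime (enum : Fin N ≃ G.Solution) (A : ComparisonSort N)
    (rank : G.Solution → ℝ) (hrank : Function.Injective rank) :
    (N : ℝ) * Real.log N ≤ meanBatchTime enum A rank := by
  have hf : (0 : ℝ) < N.factorial := by exact_mod_cast N.factorial_pos
  rw [meanBatchTime, le_div_iff₀ hf, mul_comm]
  refine (A.mul_log_le_sum (fun i => rank (enum i))
    (hrank.comp enum.injective)).trans (Finset.sum_le_sum fun σ _ => ?_)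
  simp only [batchTime, Nat.cast_add, Equiv.trans_apply]
  gcongr
  exact le_sum_length (σ.trans enum)

/-- Averaging: with the enumeration fixed, let the ranking run through all permutations of `0, ...,
N - 1`. Some permutation costs at least the mean. -/
theorem exists_mul_log_le_batchTime (enum : Fin N ≃ G.Solution) (A : ComparisonSort N) :
    ∃ rank : G.Solution → ℝ, Function.Injective rank ∧
      (N : ℝ) * Real.log N ≤ (batchTime enum A rank : ℝ) := by
  have h := A.mul_log_le_sum (fun i => (i : ℝ))
    fun a b h => Fin.ext (Nat.cast_injective h)
  have h' : ∑ _σ : Equiv.Perm (Fin N), ((N : ℝ) * Real.log N) ≤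
      ∑ σ : Equiv.Perm (Fin N), ((N : ℝ) + A.tree.comparisons (fun i => ((σ i : ℕ) : ℝ))) := by
    simpa [Fintype.card_perm] using h
  obtain ⟨σ, -, hσ⟩ := Finset.exists_le_of_sum_le Finset.univ_nonempty h'
  refine ⟨fun p => ((σ (enum.symm p) : ℕ) : ℝ), fun p q h => ?_, hσ.trans ?_⟩
  · exact enum.symm.injective (σ.injective (Fin.ext (Nat.cast_injective h)))
  · simp only [batchTime, Nat.cast_add, Equiv.symm_apply_apply]
    gcongr
    exact le_sum_length enum

end

/-! ### Paths in the multi-stage DAG of a Cartesian product -/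

section

variable {n ℓ : ℕ} {W : Type}

namespace CPNode

/-- The path through the tuples chosen by `f`, from stage `ℓ - k` on. -/
def suffixPath (f : Fin ℓ → Fin n) : (k : ℕ) → k ≤ ℓ → List (CPNode n ℓ)
  | 0, _ => [target]
  | k + 1, h => tuple ⟨ℓ - (k + 1), by omega⟩ (f ⟨ℓ - (k + 1), by omega⟩) ::
      suffixPath f k (by omega)

theorem suffixPath_head (f : Fin ℓ → Fin n) (k : ℕ) (hk : k ≤ ℓ) :
    ∃ v ∈ stage n ℓ (ℓ - k), (suffixPath f k hk).head? = some v := by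
  cases k with
  | zero => exact ⟨target, by simp [stage], rfl⟩
  | succ k => exact ⟨_, by simp [stage, show ℓ - (k + 1) < ℓ by omega], rfl⟩

theorem suffixPath_getLast (f : Fin ℓ → Fin n) (k : ℕ) (hk : k ≤ ℓ) :
    (suffixPath f k hk).getLast? = some target := by
  induction k with
  | zero => rfl
  | succ k ih => rw [suffixPath, List.getLast?_cons, ih]; rfl

theorem suffixPath_isChain (f : Fin ℓ → Fin n) (k : ℕ) (hk : k ≤ ℓ) :
    (suffixPath f k hk).IsChain (fun u v => v ∈ succ u) := by
  induction k with
  | zero => simp [suffixPath]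
  | succ k ih =>
    rw [suffixPath, List.isChain_cons]
    refine ⟨fun y hy => ?_, ih _⟩
    obtain ⟨v, hv, h⟩ := suffixPath_head f k (by omega)
    rw [h, Option.mem_some_iff] at hy
    subst hy
    simp only [succ]
    rwa [show ℓ - (k + 1) + 1 = ℓ - k by omega]

theorem suffixPath_congr {f g : Fin ℓ → Fin n} (k : ℕ) (hk : k ≤ ℓ)
    (h : ∀ i : Fin ℓ, ℓ - k ≤ i → f i = g i) : suffixPath f k hk = suffixPath g k hk := by
  induction k with
  | zero => rfl
  | succ k ih =>
    rw [suffixPath, suffixPath, h _ le_rfl, ih _ fun i hi => h i (by omega)]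

theorem eq_of_suffixPath_eq {f g : Fin ℓ → Fin n} (k : ℕ) (hk : k ≤ ℓ)
    (h : suffixPath f k hk = suffixPath g k hk) (i : Fin ℓ) (hi : ℓ - k ≤ i) : f i = g i := by
  induction k with
  | zero => exact absurd i.2 (by omega)
  | succ k ih =>
    rw [suffixPath, suffixPath, List.cons.injEq, tuple.injEq] at h
    rcases eq_or_lt_of_le hi with h' | h'
    · have : i = ⟨ℓ - (k + 1), by omega⟩ := Fin.ext h'.symm
      rw [this]
      exact h.1.2
    · exact ih _ h.2 (by omega)

theorem exists_eq_suffixPath [Nonempty (Fin n)] (k : ℕ) (hk : k ≤ ℓ) (v : CPNode n ℓ)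
    (hv : v ∈ stage n ℓ (ℓ - k)) (p : List (CPNode n ℓ))
    (hlast : (v :: p).getLast? = some target)
    (hp : (v :: p).IsChain (fun u v => v ∈ succ u)) : ∃ f, v :: p = suffixPath f k hk := by
  induction k generalizing v p with
  | zero =>
    have hv' : v = target := by simpa [stage] using hv
    subst hv'
    cases p with
    | nil => exact ⟨fun _ => Classical.arbitrary _, rfl⟩
    | cons u p => simp [succ] at hp
  | succ k ih =>
    have hlt : ℓ - (k + 1) < ℓ := by omega
    simp only [stage, hlt, dif_pos, List.mem_map, List.mem_finRange, true_and] at hv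
    obtain ⟨j, rfl⟩ := hv
    cases p with
    | nil => simp at hlast
    | cons u p =>
      rw [List.isChain_cons_cons] at hp
      have hu : u ∈ stage n ℓ (ℓ - k) := by
        have := hp.1
        simp only [succ] at this
        rwa [show ℓ - (k + 1) + 1 = ℓ - k by omega] at this
      rw [List.getLast?_cons_cons] at hlast
      obtain ⟨f, hf⟩ := ih (by omega) u hu p hlast hp.2
      -- The tail depends only on the values of `f` from stage `ℓ - k` on, so the value one stage
      -- earlier can be set to `j`.
      refine ⟨Function.update f ⟨ℓ - (k + 1), hlt⟩ j, ?_⟩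
      rw [suffixPath, Function.update_self, hf]
      refine congrArg _ (suffixPath_congr _ _ fun i hi => ?_)
      rw [Function.update_of_ne]
      rintro rfl
      simp only at hi
      omega

end CPNode

open CPNode

/-- The solutions correspond to the choices of one tuple from each relation. -/
noncomputable def solutionEquiv [Zero W] (hn : 1 ≤ n) (w : Fin ℓ → Fin n → W) :
    (Fin ℓ → Fin n) ≃ (cartesianDAG n ℓ w).Solution :=
  Equiv.ofBijective
    (fun f => ⟨source :: suffixPath f ℓ le_rfl, rfl, by
        rw [List.getLast?_cons, suffixPath_getLast]; rfl, by
        rw [List.isChain_cons]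
        refine ⟨fun y hy => ?_, suffixPath_isChain f ℓ le_rfl⟩
        obtain ⟨v, hv, h⟩ := suffixPath_head f ℓ le_rfl
        rw [h, Option.mem_some_iff] at hy
        subst hy
        rw [Nat.sub_self] at hv
        exact hv⟩) <| by
    have : Nonempty (Fin n) := ⟨⟨0, hn⟩⟩
    refine ⟨fun f g h => funext fun i => ?_, fun ⟨p, hp⟩ => ?_⟩
    · exact eq_of_suffixPath_eq ℓ le_rfl (List.cons.inj (congrArg Subtype.val h)).2 i (by omega)
    · obtain ⟨h₁, h₂, h₃⟩ := hp
      match p, h₁ with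
      | [_], rfl => simp [cartesianDAG] at h₂
      | _ :: v :: p, rfl =>
        rw [List.isChain_cons_cons] at h₃
        rw [List.getLast?_cons_cons] at h₂
        have hv : v ∈ stage n ℓ (ℓ - ℓ) := by
          rw [Nat.sub_self]
          exact h₃.1
        obtain ⟨f, hf⟩ := exists_eq_suffixPath ℓ le_rfl v hv p h₂ h₃.2
        exact ⟨f, Subtype.ext (congrArg (List.cons _) hf.symm)⟩

theorem card_solution [Zero W] (hn : 1 ≤ n) (w : Fin ℓ → Fin n → W) :
    Nat.card (cartesianDAG n ℓ w).Solution = n ^ ℓ := by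
  rw [← Nat.card_congr (solutionEquiv hn w)]
  simp

theorem pathWeight_suffixPath [AddCommMonoid W] (w : Fin ℓ → Fin n → W) (f : Fin ℓ → Fin n) (k : ℕ)
    (hk : k ≤ ℓ) (u : CPNode n ℓ) :
    (cartesianDAG n ℓ w).pathWeight (u :: suffixPath f k hk) =
      ∑ i with ℓ - k ≤ (i : Fin ℓ).val, w i (f i) := by
  induction k generalizing u with
  | zero =>
    rw [Finset.sum_eq_zero fun i hi => absurd (Finset.mem_filter.1 hi).2 (by omega)]
    simp [suffixPath, WeightedDAG.pathWeight, cartesianDAG, CPNode.weight]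
  | succ k ih =>
    rw [suffixPath, WeightedDAG.pathWeight, ih]
    have : (Finset.univ.filter fun i : Fin ℓ => ℓ - (k + 1) ≤ i.val) =
        insert ⟨ℓ - (k + 1), by omega⟩ (Finset.univ.filter fun i : Fin ℓ => ℓ - k ≤ i.val) := by
      ext i
      simp only [Finset.mem_filter, Finset.mem_univ, true_and, Finset.mem_insert, Fin.ext_iff]
      omega
    rw [this, Finset.sum_insert]
    · rfl
    · simp only [Finset.mem_filter, Finset.mem_univ, true_and]
      omega

theorem pathWeight_solutionEquiv [AddCommMonoid W] (hn : 1 ≤ n) (w : Fin ℓ → Fin n → W)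
    (f : Fin ℓ → Fin n) :
    (cartesianDAG n ℓ w).pathWeight (solutionEquiv hn w f).val = ∑ i, w i (f i) :=
  (pathWeight_suffixPath w f ℓ le_rfl source).trans (by simp)

/-- With weight `j * n ^ i` for tuple `j` of relation `i`, the weight of a path is the number whose
base-`n` digits are its choices. -/
theorem exists_injective_pathWeight (hn : 1 ≤ n) : ∃ w : Fin ℓ → Fin n → ℝ,
    Function.Injective fun p : (cartesianDAG n ℓ w).Solution =>
      (cartesianDAG n ℓ w).pathWeight p.val := by
  refine ⟨fun i j => ((j * n ^ (i : ℕ) : ℕ) : ℝ), fun p q h => ?_⟩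
  obtain ⟨f, rfl⟩ := (solutionEquiv hn _).surjective p
  obtain ⟨g, rfl⟩ := (solutionEquiv hn _).surjective q
  simp only [pathWeight_solutionEquiv, ← Nat.cast_sum] at h
  have h' := Nat.cast_injective h
  refine congrArg _ (finFunctionFinEquiv.injective (Fin.ext ?_))
  simpa only [finFunctionFinEquiv_apply] using h'

end

/-! ### Leftist heaps -/

namespace Heap

variable {V W : Type} [LinearOrder W]

/-- The elements of a heap. -/
def items {α : Type} : Heap α → Multiset α
  | nil => 0
  | node _ x l r => x ::ₘ (l.items + r.items)

/-- The root of a heap. -/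
def root? {α : Type} : Heap α → Option α
  | nil => none
  | node _ x _ _ => some x

theorem npl_node {α : Type} (k : ℕ) (x : α) (l r : Heap α) : (node k x l r).npl = k := rfl

/-- Heaps that are ordered by weight and leftist, with correct lengths of the right spines. -/
def Valid : Heap (Suffix V W) → Prop
  | nil => True
  | node k x l r => k = r.npl + 1 ∧ r.npl ≤ l.npl ∧ (∀ y ∈ l.items + r.items, x.weight ≤ y.weight) ∧
      l.Valid ∧ r.Valid

theorem items_make {α : Type} (x : α) (a b : Heap α) :
    (make x a b).items = x ::ₘ (a.items + b.items) := by
  unfold make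
  split <;> simp [items, add_comm]

theorem Valid.make {x : Suffix V W} {a b : Heap (Suffix V W)} (ha : a.Valid) (hb : b.Valid)
    (h : ∀ y ∈ a.items + b.items, x.weight ≤ y.weight) : (make x a b).Valid := by
  unfold Heap.make
  split
  · exact ⟨rfl, by assumption, h, ha, hb⟩
  · exact ⟨rfl, by omega, by rwa [add_comm], hb, ha⟩

theorem Valid.root_le {k : ℕ} {x : Suffix V W} {l r : Heap (Suffix V W)} (h : (node k x l r).Valid) :
    ∀ y ∈ (node k x l r).items, x.weight ≤ y.weight := by
  intro y hy
  rcases Multiset.mem_cons.1 hy with rfl | hy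
  · exact le_rfl
  · exact h.2.2.1 y hy

/-- Both children have right spines at least as long as that of the right child, so the size doubles
with each unit of `npl`. This makes right spines logarithmic. -/
theorem Valid.two_pow_npl_le {h : Heap (Suffix V W)} (hv : h.Valid) :
    2 ^ h.npl ≤ h.items.card + 1 := by
  induction h with
  | nil => simp [npl, items]
  | node k x l r ihl ihr =>
    obtain ⟨rfl, hlr, -, hl, hr⟩ := hv
    have h₁ := ihl hl
    have h₂ := ihr hr
    have h₃ : 2 ^ r.npl ≤ 2 ^ l.npl := Nat.pow_le_pow_right (by norm_num) hlr
    simp only [npl_node, items, Multiset.card_cons, Multiset.card_add, pow_succ]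
    omega

theorem Valid.npl_le_log {h : Heap (Suffix V W)} (hv : h.Valid) {n : ℕ} (hn : h.items.card ≤ n) :
    h.npl ≤ Nat.log 2 (n + 1) :=
  Nat.le_log_of_pow_le (by norm_num) (hv.two_pow_npl_le.trans (by omega))

/-- Each recursive call shortens one of the two right spines by one and costs two steps, the tick
and the comparison; the last call costs one. -/
theorem merge_spec (a b : Heap (Suffix V W)) (ha : a.Valid) (hb : b.Valid) :
    (merge a b).val.items = a.items + b.items ∧ (merge a b).val.Valid ∧
      (merge a b).steps ≤ 2 * (a.npl + b.npl) + 1 := by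
  induction a, b using merge.induct with
  | case1 h =>
    rw [merge]
    exact ⟨by simp [items, bind, pure], hb, by simp [bind, pure, Timed.tick]⟩
  | case2 k x l r =>
    rw [merge]
    exact ⟨by simp [items, bind, pure], ha, by simp [bind, pure, Timed.tick]⟩
  | case3 k x l r k' y l' r' ih₁ ih₂ =>
    rw [merge]
    by_cases hxy : x.weight ≤ y.weight
    · obtain ⟨h₁, h₂, h₃⟩ := ih₁ ha.2.2.2.2 hb
      have hk := ha.1
      simp only [bind, pure, Timed.tick, Timed.le, hxy, decide_true, if_true]
      refine ⟨?_, ha.2.2.2.1.make h₂ ?_, ?_⟩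
      · rw [items_make, h₁]
        simp only [items, ← Multiset.singleton_add]
        abel
      · rw [h₁]
        intro z hz
        rw [← add_assoc, Multiset.mem_add] at hz
        rcases hz with hz | hz
        · exact ha.2.2.1 z hz
        · exact hxy.trans (hb.root_le z hz)
      · simp only [npl_node] at h₃ ⊢
        omega
    · obtain ⟨h₁, h₂, h₃⟩ := ih₂ ha hb.2.2.2.2
      have hk := hb.1
      simp only [bind, pure, Timed.tick, Timed.le, hxy, decide_false, Bool.false_eq_true, if_false]
      refine ⟨?_, hb.2.2.2.1.make h₂ ?_, ?_⟩
      · rw [items_make, h₁]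
        simp only [items, ← Multiset.singleton_add]
        abel
      · rw [h₁]
        intro z hz
        rw [add_left_comm, Multiset.mem_add] at hz
        rcases hz with hz | hz
        · exact (le_of_not_ge hxy).trans (ha.root_le z hz)
        · exact hb.2.2.1 z hz
      · simp only [npl_node] at h₃ ⊢
        omega

theorem merge_steps_le {a b : Heap (Suffix V W)} (ha : a.Valid) (hb : b.Valid) {n : ℕ}
    (hna : a.items.card ≤ n) (hnb : b.items.card ≤ n) :
    (merge a b).steps ≤ 4 * Nat.log 2 (n + 1) + 1 := by
  have h₁ := (merge_spec a b ha hb).2.2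
  have h₂ := ha.npl_le_log hna
  have h₃ := hb.npl_le_log hnb
  omega

theorem valid_singleton (x : Suffix V W) : (node 1 x nil nil).Valid := by
  simp [Valid, npl, items]

theorem add_spec (x : Suffix V W) (h : Heap (Suffix V W)) (hv : h.Valid) :
    (add x h).val.items = x ::ₘ h.items ∧ (add x h).val.Valid := by
  obtain ⟨h₁, h₂, -⟩ := merge_spec _ h (valid_singleton x) hv
  exact ⟨by rw [add, h₁]; simp [items], h₂⟩

theorem add_steps_le (x : Suffix V W) {h : Heap (Suffix V W)} (hv : h.Valid) {n : ℕ} (hn : 1 ≤ n)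
    (hnh : h.items.card ≤ n) : (add x h).steps ≤ 4 * Nat.log 2 (n + 1) + 1 :=
  merge_steps_le (valid_singleton x) hv (by simpa [items]) hnh

theorem popMin_spec {h h' : Heap (Suffix V W)} {e : Suffix V W} (hv : h.Valid)
    (he : (popMin h).val = some (e, h')) :
    h.items = e ::ₘ h'.items ∧ h'.Valid ∧ h.root? = some e ∧
      ∀ y ∈ h'.items, e.weight ≤ y.weight := by
  cases h with
  | nil => simp [popMin, bind, pure] at he
  | node k x l r =>
    obtain ⟨h₁, h₂, -⟩ := merge_spec l r hv.2.2.2.1 hv.2.2.2.2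
    simp only [popMin, bind, pure, Option.some.injEq, Prod.mk.injEq] at he
    obtain ⟨rfl, rfl⟩ := he
    exact ⟨by rw [h₁, items], h₂, rfl, by rw [h₁]; exact hv.2.2.1⟩

theorem popMin_eq_none {h : Heap (Suffix V W)} (he : (popMin h).val = none) :
    h = nil ∧ (popMin h).steps = 1 := by
  cases h with
  | nil => simp [popMin, bind, pure, Timed.tick]
  | node k x l r => simp [popMin, bind, pure] at he

theorem popMin_steps_le {h : Heap (Suffix V W)} (hv : h.Valid) {n : ℕ} (hn : h.items.card ≤ n) :
    (popMin h).steps ≤ 4 * Nat.log 2 (n + 1) + 2 := by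
  cases h with
  | nil => simp [popMin, bind, pure, Timed.tick]
  | node k x l r =>
    simp only [items, Multiset.card_cons, Multiset.card_add] at hn
    have := merge_steps_le hv.2.2.2.1 hv.2.2.2.2 (n := n) (by omega) (by omega)
    simp only [popMin, bind, pure, Timed.tick]
    omega

/-- With `K = 4 log (n + 1) + 2`, every merge is charged `K`, including the tick of its call. This
gives only `O(n log n)` for a heap of `n` elements, which suffices below. The credit `K` on the left
closes the induction: of the two credits left by the halves, one pays for the merge and one is
handed on. -/
theorem buildAux_spec (m : ℕ) (xs : List (Suffix V W)) {n : ℕ} (hm : m ≤ xs.length) (hn : m ≤ n) :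
    (buildAux m xs).val.1.items = ↑(xs.take m) ∧ (buildAux m xs).val.2 = xs.drop m ∧
      (buildAux m xs).val.1.Valid ∧
      (buildAux m xs).steps + (4 * Nat.log 2 (n + 1) + 2) ≤
        2 * max m 1 * (4 * Nat.log 2 (n + 1) + 2) := by
  induction m using Nat.strong_induction_on generalizing xs with
  | _ m ih =>
    match m, xs, hm with
    | 0, xs, _ =>
      rw [buildAux]
      simp [items, Valid, bind, pure, Timed.tick]
      omega
    | 1, x :: xs, _ =>
      rw [buildAux]
      simp [items, valid_singleton, bind, pure, Timed.tick]
      omega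
    | m + 2, xs, hm =>
      rw [buildAux]
      simp only [bind, pure, Timed.tick]
      have hq : (m + 2) / 2 < m + 2 := by omega
      have hq' : m + 2 - (m + 2) / 2 < m + 2 := by omega
      obtain ⟨a₁, a₂, a₃, a₄⟩ := ih _ hq xs (by omega) (by omega)
      obtain ⟨b₁, b₂, b₃, b₄⟩ := ih _ hq' (xs.drop ((m + 2) / 2))
        (by rw [List.length_drop]; omega) (by omega)
      rw [a₂]
      obtain ⟨c₁, c₂, -⟩ := merge_spec _ _ a₃ b₃
      have c₃ := merge_steps_le a₃ b₃ (n := n) (by rw [a₁]; simp; omega) (by rw [b₁]; simp; omega)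
      refine ⟨?_, ?_, c₂, ?_⟩
      · rw [c₁, a₁, b₁, Multiset.coe_add, ← List.take_add]
        congr 2
        omega
      · rw [b₂, List.drop_drop]
        congr 1
        omega
      · rw [max_eq_left (by omega)] at a₄ b₄ ⊢
        have : 2 * (m + 2) * (4 * Nat.log 2 (n + 1) + 2) =
            2 * ((m + 2) / 2) * (4 * Nat.log 2 (n + 1) + 2) +
            2 * (m + 2 - (m + 2) / 2) * (4 * Nat.log 2 (n + 1) + 2) := by
          rw [← add_mul]
          congr 1
          omega
        change 1 + ((buildAux ((m + 2) / 2) xs).steps +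
          ((buildAux (m + 2 - (m + 2) / 2) (xs.drop ((m + 2) / 2))).steps +
          ((merge (buildAux ((m + 2) / 2) xs).val.1
            (buildAux (m + 2 - (m + 2) / 2) (xs.drop ((m + 2) / 2))).val.1).steps + 0))) + _ ≤ _
        omega

theorem build_spec (xs : List (Suffix V W)) {n : ℕ} (hn : xs.length ≤ n) :
    (build xs).val.items = ↑xs ∧ (build xs).val.Valid ∧
      (build xs).steps ≤ 2 * xs.length * (4 * Nat.log 2 (n + 1) + 2) + 1 := by
  obtain ⟨h₁, -, h₃, h₄⟩ := buildAux_spec xs.length xs le_rfl hn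
  refine ⟨by simpa [build, bind, pure] using h₁, h₃, ?_⟩
  simp only [build, bind, pure, add_zero]
  cases xs with
  | nil => simp [buildAux, bind, pure, Timed.tick]
  | cons x xs =>
    rw [max_eq_left (by simp)] at h₄
    omega

end Heap

/-! ### Reasoning about programs with memory access -/

namespace AnyKRec

section

variable {V W α β : Type}

/-- The result, the final memory and the number of steps of `x`, started with the memory `M`,
satisfy `Q`. -/
def wp (x : Program V W α) (M : Memory V W) (Q : α → Memory V W → ℕ → Prop) : Prop :=
  Q (x M).val.1 (x M).val.2 (x M).steps

variable {M : Memory V W} {Q Q' : α → Memory V W → ℕ → Prop}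

theorem wp_mono {x : Program V W α} (h : wp x M Q) (hQ : ∀ a M' t, Q a M' t → Q' a M' t) :
    wp x M Q' :=
  hQ _ _ _ h

/-- Programs are deterministic state-passing functions, so this rule and those for memory accesses
hold by unfolding. The postcondition of the first program takes over its step count, so costs add up
along the program. -/
theorem wp_bind {x : Program V W β} {f : β → Program V W α} :
    wp (x >>= f) M Q ↔
      wp x M fun a M' t => wp (f a) M' fun b M'' t' => Q b M'' (t + t') :=
  Iff.rfl

theorem wp_pure {a : α} : wp (pure a) M Q ↔ Q a M 0 := Iff.rfl

theorem wp_lift {x : Timed α} : wp (liftM x : Program V W α) M Q ↔ Q x.val M x.steps := Iff.rfl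

theorem wp_ite {p : Prop} [Decidable p] {x y : Program V W α} :
    wp (if p then x else y) M Q ↔ if p then wp x M Q else wp y M Q := by
  split <;> rfl

theorem wp_tick {Q : Unit → Memory V W → ℕ → Prop} : wp tick M Q ↔ Q () M 1 := Iff.rfl

theorem wp_readBest {v : V} {Q : Option W → Memory V W → ℕ → Prop} :
    wp (readBest v) M Q ↔ Q (M.best v) M 1 := Iff.rfl

theorem wp_readChoices {v : V} {Q : Heap (Suffix V W) → Memory V W → ℕ → Prop} :
    wp (readChoices v) M Q ↔ Q (M.choices v) M 1 := Iff.rfl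

theorem wp_readSorted {v : V} {k : ℕ} {Q : Option (Suffix V W) → Memory V W → ℕ → Prop} :
    wp (readSorted v k) M Q ↔ Q (M.sorted v)[k]? M 1 := Iff.rfl

theorem wp_readSortedSize {v : V} {Q : ℕ → Memory V W → ℕ → Prop} :
    wp (readSortedSize v) M Q ↔ Q (M.sorted v).size M 1 := Iff.rfl

variable [DecidableEq V] {Q : Unit → Memory V W → ℕ → Prop}

theorem wp_writeBest {v : V} {x : W} : wp (writeBest v x) M Q ↔
    Q () { M with best := Function.update M.best v (some x) } 1 := Iff.rfl

theorem wp_writeChoices {v : V} {h : Heap (Suffix V W)} : wp (writeChoices v h) M Q ↔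
    Q () { M with choices := Function.update M.choices v h } 1 := Iff.rfl

theorem wp_pushSorted {v : V} {e : Suffix V W} : wp (pushSorted v e) M Q ↔
    Q () { M with sorted := Function.update M.sorted v ((M.sorted v).push e) } 1 := Iff.rfl

end

/-! ### The invariant of anyK-rec -/

variable {V W : Type}

/-- The weight of the suffix of `u` of rank `r` is known to be `x`. -/
def HasWeight (M : Memory V W) (u : V) (r : ℕ) (x : W) : Prop :=
  (∃ e, (M.sorted u)[r]? = some e ∧ e.weight = x) ∨
    -- Before the first visit of `u`, and always at the target, the weight of the shortest suffix is
    -- known only from DP.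
    (r = 0 ∧ M.sorted u = #[] ∧ M.best u = some x)

/-- The child and the rank of a suffix. -/
def key (e : Suffix V W) : Σ _ : V, ℕ := ⟨e.child, e.rank⟩

/-- The number of suffixes in all sorted lists. -/
def found (G : WeightedDAG V W) (M : Memory V W) : ℕ :=
  (G.nodes.map fun v => (M.sorted v).size).sum

/-- `M'` arises from `M` by finding more suffixes. -/
structure Extends (M M' : Memory V W) : Prop where
  best_eq : M'.best = M.best
  getElem? : ∀ (v : V) (k : ℕ) (e : Suffix V W), (M.sorted v)[k]? = some e → (M'.sorted v)[k]? = some e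
  hasWeight : ∀ u r x, HasWeight M u r x → HasWeight M' u r x

theorem Extends.refl (M : Memory V W) : Extends M M :=
  ⟨rfl, fun _ _ _ h => h, fun _ _ _ h => h⟩

theorem Extends.trans {M M' M'' : Memory V W} (h : Extends M M') (h' : Extends M' M'') :
    Extends M M'' :=
  ⟨h'.best_eq.trans h.best_eq, fun v k e he => h'.getElem? v k e (h.getElem? v k e he),
    fun u r x hx => h'.hasWeight u r x (h.hasWeight u r x hx)⟩

theorem Extends.size_le {M M' : Memory V W} (h : Extends M M') (v : V) :
    (M.sorted v).size ≤ (M'.sorted v).size := by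
  by_contra! hlt
  have := h.getElem? v _ _ (Array.getElem?_eq_getElem hlt)
  simp at this

theorem Extends.of_sorted_best {M M' : Memory V W} (hs : M'.sorted = M.sorted)
    (hb : M'.best = M.best) : Extends M M' :=
  ⟨hb, fun _ _ _ h => by rwa [hs], fun _ _ _ h => by rwa [HasWeight, hs, hb]⟩

theorem initialChoices_spec [AddCommMonoid W] {G : WeightedDAG V W} {M : Memory V W} (v : V) (us : List V) (hus : ∀ u ∈ us, ∃ x, M.best u = some x) :
    wp (initialChoices G v us) M fun xs M' t => M' = M ∧
      xs = us.map (fun u => ⟨u, 0, G.weight v u + (M.best u).getD 0⟩) ∧ t = 3 * us.length + 1 := by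
  induction us with
  | nil =>
    simp only [initialChoices]
    exact ⟨rfl, rfl, rfl⟩
  | cons u us ih =>
    obtain ⟨x, hx⟩ := hus u (by simp)
    simp only [initialChoices, wp_bind, wp_tick, wp_readBest, hx, wp_lift, wp_pure]
    refine wp_mono (ih fun u' hu' => hus u' (by simp [hu'])) ?_
    rintro _ _ _ ⟨rfl, rfl, rfl⟩
    refine ⟨rfl, by simp [Timed.add, hx], ?_⟩
    simp only [Timed.add, List.length_cons]
    ring

variable [AddCommMonoid W] [LinearOrder W]

/-- The invariant at a node `v` other than the target; `c u` is the rank of the next suffix of `v`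
through `u`. -/
structure NodeInv (G : WeightedDAG V W) (tot : V → ℕ) (M : Memory V W) (v : V) (c : V → ℕ) :
    Prop where
  valid : (M.choices v).Valid
  cursor_le : ∀ u ∈ G.succ v, c u ≤ tot u
  choices_nodup : ((M.choices v).items.map Suffix.child).Nodup
  of_mem_choices : ∀ e ∈ (M.choices v).items,
    e.child ∈ G.succ v ∧ e.rank = c e.child ∧ e.rank < tot e.child
  exists_mem_choices : ∀ u ∈ G.succ v, c u < tot u → ∃ e ∈ (M.choices v).items, e.child = u
  choices_weight : ∀ e ∈ (M.choices v).items,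
    ∃ x, HasWeight M e.child e.rank x ∧ e.weight = G.weight v e.child + x
  sorted_nodup : ((M.sorted v).toList.map key).Nodup
  mem_sorted : ∀ q, q ∈ (M.sorted v).toList.map key ↔ q.1 ∈ G.succ v ∧ q.2 < c q.1
  -- A listed suffix points to one that is itself listed (or to the target), so `assemble` can
  -- follow the pointers without searching.
  sorted_weight : ∀ e ∈ (M.sorted v).toList, (e.child = G.target ∨
    e.rank < (M.sorted e.child).size) ∧
    ∃ x, HasWeight M e.child e.rank x ∧ e.weight = G.weight v e.child + x
  pairwise : (M.sorted v).toList.Pairwise fun e e' => e.weight ≤ e'.weight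
  sorted_le_choices : ∀ e ∈ (M.sorted v).toList, ∀ e' ∈ (M.choices v).items, e.weight ≤ e'.weight
  -- Needed at the first pop, when the weight of rank 0 passes from `best` to the sorted list: the
  -- popped root must have the weight that the predecessors have already used.
  root_best : M.sorted v = #[] → ∃ e, (M.choices v).root? = some e ∧ M.best v = some e.weight

/-- The invariant at a node. -/
def Inv (G : WeightedDAG V W) (tot : V → ℕ) (M : Memory V W) (v : V) : Prop :=
  (v = G.target → M.sorted v = #[] ∧ M.best v = some 0) ∧
    (v ≠ G.target → ∃ c, NodeInv G tot M v c)

variable {G : WeightedDAG V W} {height tot : V → ℕ} {n : ℕ} {M M' : Memory V W} {v : V} {c : V → ℕ}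

theorem Inv.congr (h : Inv G tot M v) (hs : M'.sorted v = M.sorted v)
    (hc : M'.choices v = M.choices v) (hb : M'.best v = M.best v)
    (hw : ∀ u ∈ G.succ v, ∀ r x, HasWeight M u r x → HasWeight M' u r x)
    (hz : ∀ u ∈ G.succ v, (M.sorted u).size ≤ (M'.sorted u).size) : Inv G tot M' v := by
  refine ⟨fun hv => by rw [hs, hb]; exact h.1 hv, fun hv => ?_⟩
  obtain ⟨c, hN⟩ := h.2 hv
  refine ⟨c, ?_⟩
  have hchild : ∀ e ∈ (M.sorted v).toList, e.child ∈ G.succ v := fun e he =>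
    ((hN.mem_sorted (key e)).1 (List.mem_map_of_mem he)).1
  constructor <;> (try rw [hs]) <;> (try rw [hc]) <;> (try rw [hb])
  · exact hN.valid
  · exact hN.cursor_le
  · exact hN.choices_nodup
  · exact hN.of_mem_choices
  · exact hN.exists_mem_choices
  · intro e he
    obtain ⟨x, hx, hx'⟩ := hN.choices_weight e he
    exact ⟨x, hw _ (hN.of_mem_choices e he).1 _ _ hx, hx'⟩
  · exact hN.sorted_nodup
  · exact hN.mem_sorted
  · intro e he
    obtain ⟨h', x, hx, hx'⟩ := hN.sorted_weight e he
    exact ⟨h'.imp_right fun h' => h'.trans_le (hz _ (hchild e he)), x,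
      hw _ (hchild e he) _ _ hx, hx'⟩
  · exact hN.pairwise
  · exact hN.sorted_le_choices
  · exact hN.root_best

theorem Inv.of_extends (h : Inv G tot M v) (hs : M'.sorted v = M.sorted v)
    (hc : M'.choices v = M.choices v) (he : Extends M M') : Inv G tot M' v :=
  h.congr hs hc (by rw [he.best_eq]) (fun u _ => he.hasWeight u) fun u _ => he.size_le u

variable [DecidableEq V]

/-- A height function and the numbers of suffixes of the nodes of a DAG whose nodes all have a
suffix; `n` bounds the numbers of successors. -/
structure SuffixCount (G : WeightedDAG V W) (height tot : V → ℕ) (n : ℕ) : Prop where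
  height_lt : ∀ v, ∀ u ∈ G.succ v, height u < height v
  tot_target : tot G.target = 1
  tot_eq : ∀ v, v ≠ G.target → tot v = ∑ u ∈ (G.succ v).toFinset, tot u
  tot_pos : ∀ v, 0 < tot v
  length_succ_le : ∀ v, (G.succ v).length ≤ n

namespace NodeInv

/-- The keys in the list are distinct and are the pairs `(u, r)` with `r < c u`. So the list is full
exactly when every cursor has reached its end, and exactly then the queue is empty. -/
theorem size_eq (h : NodeInv G tot M v c) :
    (M.sorted v).size = ∑ u ∈ (G.succ v).toFinset, c u := by
  have h₁ := List.toFinset_card_of_nodup h.sorted_nodup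
  have h₂ : ((M.sorted v).toList.map key).toFinset =
      (G.succ v).toFinset.sigma fun u => Finset.range (c u) := by
    ext q
    rw [List.mem_toFinset, h.mem_sorted]
    simp
  rw [h₂, Finset.card_sigma] at h₁
  simpa using h₁.symm

theorem size_le_tot (h : NodeInv G tot M v c) (hG : SuffixCount G height tot n)
    (hv : v ≠ G.target) : (M.sorted v).size ≤ tot v := by
  rw [h.size_eq, hG.tot_eq v hv]
  exact Finset.sum_le_sum fun u hu => h.cursor_le u (List.mem_toFinset.1 hu)

theorem tot_le_size_iff (h : NodeInv G tot M v c) (hG : SuffixCount G height tot n)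
    (hv : v ≠ G.target) : tot v ≤ (M.sorted v).size ↔ ∀ u ∈ G.succ v, c u = tot u := by
  have hle : ∀ u ∈ (G.succ v).toFinset, c u ≤ tot u := fun u hu =>
    h.cursor_le u (List.mem_toFinset.1 hu)
  have := Finset.sum_eq_sum_iff_of_le hle
  rw [← h.size_eq, ← hG.tot_eq v hv] at this
  have hs := h.size_le_tot hG hv
  rw [← show (M.sorted v).size = tot v ↔ tot v ≤ (M.sorted v).size from
    ⟨fun h => h.ge, fun h => le_antisymm hs h⟩, this]
  simp

theorem choices_eq_nil_iff (h : NodeInv G tot M v c) (hG : SuffixCount G height tot n)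
    (hv : v ≠ G.target) : M.choices v = .nil ↔ (M.sorted v).size = tot v := by
  have hs := h.size_le_tot hG hv
  rw [show (M.sorted v).size = tot v ↔ tot v ≤ (M.sorted v).size from
    ⟨fun h => h.ge, fun h => le_antisymm hs h⟩, h.tot_le_size_iff hG hv]
  refine ⟨fun hn u hu => ?_, fun ha => ?_⟩
  · by_contra hne
    obtain ⟨e, he, -⟩ := h.exists_mem_choices u hu (lt_of_le_of_ne (h.cursor_le u hu) hne)
    simp [hn, Heap.items] at he
  · rcases hh : M.choices v with _ | ⟨k, x, l, r⟩
    · rfl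
    · have := h.of_mem_choices x (by simp [hh, Heap.items])
      have := ha _ this.1
      omega

theorem card_choices_le (h : NodeInv G tot M v c) (hG : SuffixCount G height tot n) :
    (M.choices v).items.card ≤ n := by
  rw [← Multiset.card_map Suffix.child]
  refine le_trans ?_ (hG.length_succ_le v)
  refine Multiset.card_le_card (t := (G.succ v : Multiset V))
    ((Multiset.le_iff_subset h.choices_nodup).2 fun u hu => ?_)
  obtain ⟨e, he, rfl⟩ := Multiset.mem_map.1 hu
  exact (h.of_mem_choices e he).1

end NodeInv

/-! ### Dynamic programming -/

/-- The time that DP needs at the node `v`. -/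
def dpCost (G : WeightedDAG V W) (n : ℕ) (v : V) : ℕ :=
  (G.succ v).length * (3 + 2 * (4 * Nat.log 2 (n + 1) + 2)) + 7

theorem dpNode_spec (hG : SuffixCount G height tot n) (hs : ∀ u, M.sorted u = #[])
    (hb : ∀ u ∈ G.succ v, ∃ x, M.best u = some x) :
    wp (dpNode G v) M fun _ M' t => (∀ u, M'.sorted u = #[]) ∧ Inv G tot M' v ∧
      (∀ u, u ≠ v → M'.choices u = M.choices u ∧ M'.best u = M.best u) ∧
      t + 2 ≤ dpCost G n v := by
  simp only [dpNode, wp_bind, wp_tick, wp_ite, wp_writeBest, wp_lift]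
  split_ifs with hv
  · refine ⟨hs, ⟨fun _ => ⟨hs v, by simp⟩, fun h => absurd hv h⟩, fun u hu => by simp [hu], ?_⟩
    simp only [dpCost]
    omega
  refine wp_mono (initialChoices_spec v (G.succ v) hb) ?_
  rintro xs M' t ⟨rfl, hxs, rfl⟩
  have hlen : xs.length = (G.succ v).length := by simp [hxs]
  obtain ⟨h₁, h₂, h₃⟩ := Heap.build_spec xs (hlen.le.trans (hG.length_succ_le v))
  rw [wp_writeChoices]
  rcases hh : (Heap.build xs).val with _ | ⟨k, e, l, r⟩
  -- Every node has a suffix, so a node other than the target has a successor and its queue cannot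
  -- be empty.
  · exfalso
    rw [hh] at h₁
    have hx : xs = [] := (Multiset.coe_eq_zero _).1 h₁.symm
    have h0 : G.succ v = [] := by simpa [hx] using hxs
    have := hG.tot_pos v
    rw [hG.tot_eq v hv, h0] at this
    simp at this
  simp only [wp_writeBest]
  rw [← hh]
  have hmem : ∀ e' ∈ xs, e'.child ∈ G.succ v ∧ e'.rank = 0 ∧
      e'.weight = G.weight v e'.child + (M'.best e'.child).getD 0 := by
    intro e' he'
    rw [hxs] at he'
    obtain ⟨u, hu, rfl⟩ := List.mem_map.1 he'
    exact ⟨hu, rfl, rfl⟩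
  refine ⟨hs, ⟨fun h => absurd h hv, fun _ => ⟨fun _ => 0, ?_⟩⟩, fun u hu => by simp [hu], ?_⟩
  · constructor <;> (try simp only [Function.update_self, h₁, hs, List.map_nil])
    · exact h₂
    · simp
    · rw [hxs]
      simpa [Function.comp_def] using G.succ_nodup v
    · intro e' he'
      obtain ⟨h, h', -⟩ := hmem e' (by simpa using he')
      exact ⟨h, h', h' ▸ hG.tot_pos _⟩
    · intro u hu _
      exact ⟨⟨u, 0, G.weight v u + (M'.best u).getD 0⟩, by rw [hxs]; simpa using hu, rfl⟩
    · intro e' he'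
      obtain ⟨h, h', hw⟩ := hmem e' (by simpa using he')
      obtain ⟨x, hx⟩ := hb _ h
      refine ⟨x, Or.inr ⟨h', hs _, ?_⟩, by rw [hw, hx]; rfl⟩
      refine (Function.update_of_ne (fun heq => ?_) _ _).trans hx
      exact G.not_mem_succ_self v (heq ▸ h)
    · simp
    · simp
    · simp
    · simp
    · simp
    · exact fun _ => ⟨e, by rw [hh]; rfl, rfl⟩
  · rw [hlen] at h₃
    simp only [dpCost]
    rw [mul_add, ← mul_assoc, mul_comm _ 2, mul_comm _ 3]
    omega

/-- By the reverse topological order all successors of the next node are in `done`, while no node of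
`done` has an edge to it. So processing it leaves the earlier invariants intact. -/
theorem dp_spec (hG : SuffixCount G height tot n) (done todo : List V)
    (hnodes : G.nodes = done ++ todo) (hs : ∀ u, M.sorted u = #[])
    (hinv : ∀ u ∈ done, Inv G tot M u) (hbest : ∀ u ∈ done, ∃ x, M.best u = some x) :
    wp (dp G todo) M fun _ M' t => (∀ u, M'.sorted u = #[]) ∧ (∀ u, Inv G tot M' u) ∧
      t ≤ (todo.map (dpCost G n)).sum + 1 := by
  induction todo generalizing done M with
  | nil =>
    rw [List.append_nil] at hnodes
    simp only [dp, wp_tick]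
    exact ⟨hs, fun u => hinv u (hnodes ▸ G.mem_nodes u), by simp⟩
  | cons v todo ih =>
    have hp := G.reverse_topological
    rw [hnodes, List.pairwise_append, List.pairwise_cons] at hp
    obtain ⟨-, ⟨hp₁, -⟩, hp₂⟩ := hp
    have hdone : ∀ w, w ∉ done → w = v ∨ w ∈ todo := fun w hw => by
      have := G.mem_nodes w
      rw [hnodes] at this
      simpa [hw] using this
    have hsv : ∀ u ∈ G.succ v, u ∈ done := fun u hu => by
      by_contra hu'
      rcases hdone u hu' with rfl | h
      · exact G.not_mem_succ_self _ hu
      · exact hp₁ u h hu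
    have hvd : v ∉ done := fun h => by
      have := G.nodes_nodup
      rw [hnodes] at this
      exact List.disjoint_of_nodup_append this h (by simp)
    simp only [dp, wp_bind, wp_tick]
    refine wp_mono (dpNode_spec (v := v) hG hs fun u hu => hbest u (hsv u hu)) ?_
    rintro _ M' t ⟨hs', hv', hfr, ht⟩
    have hbv : ∃ x, M'.best v = some x := by
      by_cases hvt : v = G.target
      · exact ⟨_, (hv'.1 hvt).2⟩
      · obtain ⟨c, hN⟩ := hv'.2 hvt
        obtain ⟨e, -, he⟩ := hN.root_best (hs' v)
        exact ⟨_, he⟩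
    refine wp_mono (ih (M := M') (done ++ [v]) (by simp [hnodes]) hs' ?_ ?_) ?_
    · intro u hu
      rcases List.mem_append.1 hu with hud | hu
      · have hne : ∀ w ∈ done, w ≠ v := fun w hw h => hvd (h ▸ hw)
        refine (hinv u hud).congr ((hs' u).trans (hs u).symm) (hfr u (hne u hud)).1
          (hfr u (hne u hud)).2 (fun w hw r x => ?_) (fun w _ => by simp [hs, hs'])
        have hwv : w ≠ v := by
          rintro rfl
          exact hp₂ u hud w (by simp) hw
        rw [HasWeight, HasWeight, hs', hs, (hfr w hwv).2]
        exact id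
      · rw [List.mem_singleton.1 hu]
        exact hv'
    · intro u hu
      rcases List.mem_append.1 hu with hu | hu
      · rw [(hfr u fun h => hvd (h ▸ hu)).2]
        exact hbest u hu
      · rw [List.mem_singleton.1 hu]
        exact hbv
    · rintro _ M'' t' ⟨h₁, h₂, h₃⟩
      refine ⟨h₁, h₂, ?_⟩
      simp only [List.map_cons, List.sum_cons]
      omega

end AnyKRec

/-! ### Finding the next suffix of a node -/

namespace AnyKRec

variable {V W : Type}

theorem found_push [DecidableEq V] (G : WeightedDAG V W) (M M' : Memory V W) (v : V)
    (e : Suffix V W) (h : M'.sorted = Function.update M.sorted v ((M.sorted v).push e)) :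
    found G M' = found G M + 1 := by
  have key (l : List V) (hl : l.Nodup) :
      (l.map fun u => (M'.sorted u).size).sum =
        (l.map fun u => (M.sorted u).size).sum + if v ∈ l then 1 else 0 := by
    induction l with
    | nil => simp
    | cons u l ih =>
      rw [List.nodup_cons] at hl
      rw [List.map_cons, List.sum_cons, List.map_cons, List.sum_cons, ih hl.2, h]
      by_cases huv : u = v
      · subst huv
        simp [hl.1]
        omega
      · simp [huv, Ne.symm huv, add_assoc]
  have := key G.nodes G.nodes_nodup
  rwa [if_pos (G.mem_nodes v)] at this

theorem found_congr (G : WeightedDAG V W) {M M' : Memory V W} (h : M'.sorted = M.sorted) :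
    found G M' = found G M := by
  rw [found, h, found]

/-- The reason why a replacement in a queue is never lighter than the popped suffix. -/
theorem HasWeight.le_of_getElem? [LinearOrder W] {M : Memory V W} {u : V} {r : ℕ} {x : W}
    {e : Suffix V W} (h : HasWeight M u r x) (he : (M.sorted u)[r + 1]? = some e)
    (hp : (M.sorted u).toList.Pairwise fun e e' => e.weight ≤ e'.weight) : x ≤ e.weight := by
  rcases h with ⟨e', he', rfl⟩ | ⟨-, h, -⟩
  · rw [← Array.getElem?_toList] at he he'
    obtain ⟨h₁, rfl⟩ := List.getElem?_eq_some_iff.1 he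
    obtain ⟨h₂, rfl⟩ := List.getElem?_eq_some_iff.1 he'
    exact List.pairwise_iff_getElem.1 hp _ _ h₂ h₁ (Nat.lt_succ_self r)
  · simp [h] at he

variable [AddCommMonoid W] [LinearOrder W] {G : WeightedDAG V W} {height tot : V → ℕ} {n : ℕ}
  {M M' : Memory V W} {v : V} {c : V → ℕ}

section

variable [DecidableEq V]

/-- Here `M'` is the memory after the recursive call and the reinsertion; in between, the invariant
fails at `v`. The weight of `e` separates list and queue: `e` was a minimum of the old queue, and
its replacement goes through the same edge to a later suffix of the same child. -/
theorem NodeInv.pop [IsOrderedAddMonoid W] (hN : NodeInv G tot M v c) {e : Suffix V W}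
    {h' : Heap (Suffix V W)} (hitems : (M.choices v).items = e ::ₘ h'.items)
    (hle : ∀ y ∈ h'.items, e.weight ≤ y.weight) (hext : Extends M M')
    (hs : M'.sorted v = (M.sorted v).push e) (hvalid : (M'.choices v).Valid)
    (hfound : e.child = G.target ∨ e.rank < (M'.sorted e.child).size)
    (hnew : (tot e.child ≤ e.rank + 1 ∧ (M'.choices v).items = h'.items) ∨
      (e.rank + 1 < tot e.child ∧ ∃ e', (M'.sorted e.child)[e.rank + 1]? = some e' ∧
        (M'.choices v).items =
          ⟨e.child, e.rank + 1, G.weight v e.child + e'.weight⟩ ::ₘ h'.items))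
    (hchild : Inv G tot M' e.child) :
    NodeInv G tot M' v (Function.update c e.child (c e.child + 1)) := by
  obtain ⟨he₁, he₂, he₃⟩ := hN.of_mem_choices e (by simp [hitems])
  obtain ⟨x, hx, hxe⟩ := hN.choices_weight e (by simp [hitems])
  have hnd := hN.choices_nodup
  rw [hitems, Multiset.map_cons, Multiset.nodup_cons] at hnd
  have hne : ∀ y ∈ h'.items, y.child ≠ e.child := fun y hy h =>
    hnd.1 (h ▸ Multiset.mem_map_of_mem _ hy)
  have hold : ∀ y ∈ h'.items, y ∈ (M.choices v).items := fun y hy => by simp [hitems, hy]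
  have hsub : ∀ y ∈ h'.items, y ∈ (M'.choices v).items := by
    rcases hnew with ⟨-, h⟩ | ⟨-, e', -, h⟩ <;> intro y hy <;> simp [h, hy]
  have hmem : ∀ y ∈ (M'.choices v).items, y ∈ h'.items ∨ (y.child = e.child ∧
      y.rank = e.rank + 1 ∧ e.rank + 1 < tot e.child ∧ ∃ e',
        (M'.sorted e.child)[e.rank + 1]? = some e' ∧
        y.weight = G.weight v e.child + e'.weight) := by
    intro y hy
    rcases hnew with ⟨-, h⟩ | ⟨hlt, e', he', h⟩
    · exact Or.inl (h ▸ hy)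
    · rw [h] at hy
      rcases Multiset.mem_cons.1 hy with rfl | hy
      · exact Or.inr ⟨rfl, rfl, hlt, e', he', rfl⟩
      · exact Or.inl hy
  have hlist : (M'.sorted v).toList = (M.sorted v).toList ++ [e] := by rw [hs, Array.toList_push]
  have hold_weight : ∀ y : Suffix V W,
      (∃ x, HasWeight M y.child y.rank x ∧ y.weight = G.weight v y.child + x) →
      ∃ x, HasWeight M' y.child y.rank x ∧ y.weight = G.weight v y.child + x :=
    fun y ⟨x, hx, hy⟩ => ⟨x, hext.hasWeight _ _ _ hx, hy⟩
  constructor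
  · exact hvalid
  · intro u hu
    by_cases h : u = e.child
    · subst h
      rw [Function.update_self]
      omega
    · rw [Function.update_of_ne h]
      exact hN.cursor_le u hu
  · rcases hnew with ⟨-, h⟩ | ⟨-, e', -, h⟩
    · rw [h]
      exact hnd.2
    · rw [h, Multiset.map_cons, Multiset.nodup_cons]
      exact hnd
  · intro y hy
    rcases hmem y hy with hy | ⟨h₁, h₂, h₃, -⟩
    · rw [Function.update_of_ne (hne y hy)]
      exact hN.of_mem_choices y (hold y hy)
    · rw [h₁, Function.update_self, h₂]
      exact ⟨he₁, by omega, h₃⟩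
  · intro u hu hlt
    by_cases h : u = e.child
    · subst h
      rw [Function.update_self, ← he₂] at hlt
      rcases hnew with ⟨h, -⟩ | ⟨-, e', -, h⟩
      · omega
      · rw [h]
        exact ⟨_, Multiset.mem_cons_self _ _, rfl⟩
    · rw [Function.update_of_ne h] at hlt
      obtain ⟨y, hy, rfl⟩ := hN.exists_mem_choices u hu hlt
      rw [hitems, Multiset.mem_cons] at hy
      exact ⟨y, hsub y (hy.resolve_left fun h' => h (h' ▸ rfl)), rfl⟩
  · intro y hy
    rcases hmem y hy with hy | ⟨h₁, h₂, -, e', he', hw⟩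
    · exact hold_weight y (hN.choices_weight y (hold y hy))
    · exact ⟨e'.weight, Or.inl ⟨e', by rw [h₁, h₂, he'], rfl⟩, by rw [hw, h₁]⟩
  · rw [hlist, List.map_append, List.nodup_append]
    refine ⟨hN.sorted_nodup, by simp, fun q hq q' hq' heq => ?_⟩
    have := ((hN.mem_sorted q).1 hq).2
    simp only [List.map_cons, List.map_nil, List.mem_singleton] at hq'
    rw [heq, hq'] at this
    simp only [key] at this
    omega
  · rintro ⟨u, r⟩
    rw [hlist, List.map_append, List.mem_append, hN.mem_sorted]
    simp only [List.map_cons, List.map_nil, List.mem_singleton, key, Sigma.mk.injEq]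
    by_cases h : u = e.child
    · subst h
      simp only [Function.update_self, heq_eq_eq, true_and, he₁, he₂]
      omega
    · simp [h]
  · intro y hy
    rw [hlist, List.mem_append, List.mem_singleton] at hy
    rcases hy with hy | rfl
    · obtain ⟨h₁, h₂⟩ := hN.sorted_weight y hy
      exact ⟨h₁.imp_right fun h => h.trans_le (hext.size_le _), hold_weight y h₂⟩
    · exact ⟨hfound, hold_weight y ⟨x, hx, hxe⟩⟩
  · rw [hlist, List.pairwise_append]
    refine ⟨hN.pairwise, by simp, fun y hy y' hy' => ?_⟩
    rw [List.mem_singleton.1 hy']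
    exact hN.sorted_le_choices y hy e (by simp [hitems])
  · have hy_e : ∀ y ∈ (M'.sorted v).toList, y.weight ≤ e.weight := by
      intro y hy
      rw [hlist, List.mem_append, List.mem_singleton] at hy
      rcases hy with hy | rfl
      · exact hN.sorted_le_choices y hy e (by simp [hitems])
      · exact le_rfl
    intro y hy y' hy'
    refine (hy_e y hy).trans ?_
    rcases hmem y' hy' with hy' | ⟨-, -, -, e', he', hw⟩
    · exact hle y' hy'
    · rw [hw, hxe]
      -- The target keeps no list, so a child with a listed suffix is another node and its list is
      -- sorted.
      have ht : e.child ≠ G.target := fun h => by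
        rw [(hchild.1 h).1] at he'
        simp at he'
      obtain ⟨c', hN'⟩ := hchild.2 ht
      exact add_le_add_right ((hext.hasWeight _ _ _ hx).le_of_getElem? he' hN'.pairwise) _
  · intro h
    rw [hs] at h
    simp at h

end

/-! ### Amortised cost of a request. -/

/-- The steps spent on one suffix, apart from the recursive call. -/
def popCost (n : ℕ) : ℕ := 8 * Nat.log 2 (n + 1) + 20

/-- What a subprogram working at the node `u` and below achieves in `t` steps, of which all but
`a` are paid for by the suffixes found. -/
structure Progress (G : WeightedDAG V W) (height tot : V → ℕ) (n : ℕ) (u : V) (M M' : Memory V W)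
    (t a : ℕ) : Prop where
  inv : ∀ w, height w ≤ height u → Inv G tot M' w
  ext : Extends M M'
  frame : ∀ w, height u < height w → M'.sorted w = M.sorted w ∧ M'.choices w = M.choices w
  cost : t + popCost n * found G M ≤ a + popCost n * found G M'

theorem Progress.trans {u : V} {M M' M'' : Memory V W} {t t' a a' : ℕ}
    (h : Progress G height tot n u M M' t a) (h' : Progress G height tot n u M' M'' t' a') :
    Progress G height tot n u M M'' (t + t') (a + a') where
  inv := h'.inv
  ext := h.ext.trans h'.ext
  frame w hw := ⟨(h'.frame w hw).1.trans (h.frame w hw).1, (h'.frame w hw).2.trans (h.frame w hw).2⟩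
  cost := by
    have h₁ := h.cost
    have h₂ := h'.cost
    omega

theorem Progress.refl {u : V} {M : Memory V W} (h : ∀ w, height w ≤ height u → Inv G tot M w)
    (t : ℕ) : Progress G height tot n u M M t t :=
  ⟨h, Extends.refl M, fun _ _ => ⟨rfl, rfl⟩, le_rfl⟩

theorem Progress.mono {u : V} {M M' : Memory V W} {t t' a a' : ℕ}
    (h : Progress G height tot n u M M' t a) (ht : t' + a ≤ t + a') :
    Progress G height tot n u M M' t' a' :=
  ⟨h.inv, h.ext, h.frame, by have := h.cost; omega⟩

/-- The result of asking for the suffix of `u` of rank `k`. -/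
structure NextPost (G : WeightedDAG V W) (height tot : V → ℕ) (n : ℕ) (u : V) (k : ℕ)
    (M : Memory V W) (o : Option (Suffix V W)) (M' : Memory V W) (t : ℕ) : Prop
    extends Progress G height tot n u M M' t 10 where
  eq_some : k < tot u → ∃ e, o = some e ∧ (M'.sorted u)[k]? = some e
  eq_none : tot u ≤ k → o = none
  le_size : u ≠ G.target → min (k + 1) (tot u) ≤ (M'.sorted u).size
  size_le : (M'.sorted u).size ≤ max (M.sorted u).size (k + 1)

variable [DecidableEq V]

/-- The allowance 3 pays for a failed pop from an empty queue. A successful pop lists one suffix,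
whose `popCost` covers the `8 log (n + 1) + 10` local steps and the allowance 10 of the recursive
call. The recursion may run while the invariant is broken at `v`, since it needs and touches only
nodes of smaller height. -/
theorem advance_spec [IsOrderedAddMonoid W] (hG : SuffixCount G height tot n)
    (nxt : V → ℕ → Program V W (Option (Suffix V W))) (hv : v ≠ G.target)
    (hnxt : ∀ u k M, height u < height v → (∀ w, height w ≤ height u → Inv G tot M w) →
      (u = G.target → 1 ≤ k) →
      (u ≠ G.target → k ≤ (M.sorted u).size ∨ ((M.sorted u).size = 0 ∧ k ≤ 1)) →
      wp (nxt u k) M (NextPost G height tot n u k M))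
    (hinv : ∀ w, height w ≤ height v → Inv G tot M w) :
    wp (advance G nxt v) M fun _ M' t => Progress G height tot n v M M' t 3 ∧
      (M'.sorted v).size = min ((M.sorted v).size + 1) (tot v) := by
  obtain ⟨c, hN⟩ := (hinv v le_rfl).2 hv
  simp only [advance, wp_bind, wp_tick, wp_readChoices, wp_lift]
  have hpop := Heap.popMin_steps_le hN.valid (hN.card_choices_le hG)
  rcases hr : (Heap.popMin (M.choices v)).val with _ | ⟨e, h'⟩
  · obtain ⟨h₁, h₂⟩ := Heap.popMin_eq_none hr
    have h₃ := (hN.choices_eq_nil_iff hG hv).1 h₁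
    simp only [wp_pure]
    rw [h₂]
    exact ⟨Progress.refl hinv 3, by omega⟩
  obtain ⟨hi, hval, hroot, hmin⟩ := Heap.popMin_spec hN.valid hr
  obtain ⟨he₁, he₂, he₃⟩ := hN.of_mem_choices e (by simp [hi])
  obtain ⟨x, hx, hxe⟩ := hN.choices_weight e (by simp [hi])
  have hlow := hG.height_lt v _ he₁
  have hcard := hN.card_choices_le hG
  rw [hi, Multiset.card_cons] at hcard
  have hsize : (M.sorted v).size + 1 ≤ tot v := by
    refine lt_of_le_of_ne (hN.size_le_tot hG hv) fun h => ?_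
    rw [(hN.choices_eq_nil_iff hG hv).2 h] at hi
    simp [Heap.items] at hi
  simp only [wp_bind, wp_writeChoices, wp_pushSorted]
  set M₁ : Memory V W := ⟨M.best, Function.update M.choices v h',
    Function.update M.sorted v ((M.sorted v).push e)⟩
  have hsame : ∀ w, w ≠ v → M₁.sorted w = M.sorted w ∧ M₁.choices w = M.choices w := fun w hw =>
    ⟨Function.update_of_ne hw _ _, Function.update_of_ne hw _ _⟩
  have hsv : M₁.sorted v = (M.sorted v).push e := Function.update_self _ _ _
  have hext : Extends M M₁ := by
    have hget : ∀ (w : V) (k : ℕ) (y : Suffix V W), (M.sorted w)[k]? = some y →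
        (M₁.sorted w)[k]? = some y := by
      intro w k y hy
      by_cases hw : w = v
      · subst hw
        rw [hsv, Array.getElem?_push, if_neg, hy]
        rintro rfl
        simp at hy
      · rwa [(hsame w hw).1]
    refine ⟨rfl, hget, ?_⟩
    -- A weight known only from `best` at `v` itself is now found in the list: by `root_best` the
    -- popped element has this weight.
    rintro u r y (⟨e', he', hy⟩ | ⟨rfl, h, hb⟩)
    · exact Or.inl ⟨e', hget _ _ _ he', hy⟩
    · by_cases hu : u = v
      · subst hu
        obtain ⟨e', he', hb'⟩ := hN.root_best h
        rw [hroot, Option.some.injEq] at he'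
        subst he'
        rw [hb, Option.some.injEq] at hb'
        exact Or.inl ⟨e, by rw [hsv, h]; rfl, hb'.symm⟩
      · exact Or.inr ⟨rfl, by rwa [(hsame u hu).1], hb⟩
  have hinv₁ : ∀ w, w ≠ v → height w ≤ height v → Inv G tot M₁ w := fun w hw hle =>
    (hinv w hle).of_extends (hsame w hw).1 (hsame w hw).2 hext
  have hev : e.child ≠ v := fun h => lt_irrefl _ (h ▸ hlow)
  have hcost₁ : found G M₁ = found G M + 1 := found_push G M M₁ v e rfl
  have hsc : (M₁.sorted e.child).size = (M.sorted e.child).size := by rw [(hsame _ hev).1]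
  refine wp_mono (hnxt e.child (e.rank + 1) M₁ hlow
    (fun w hw => hinv₁ w (fun h => by subst h; omega) (by omega)) (by omega) fun _ => ?_) ?_
  · rw [hsc]
    -- If the suffix of rank `e.rank` is listed at the child, the request is for at most the next
    -- unlisted rank. Otherwise `e.rank = 0`, and rank 1 is requested at an unvisited node.
    rcases hx with ⟨y, hy, -⟩ | ⟨h0, h, -⟩
    · exact Or.inl (Array.getElem?_eq_some_iff.1 hy).1
    · exact Or.inr ⟨by simp [h], by omega⟩
  intro o M₂ t hpost
  obtain ⟨hs₂, hc₂⟩ := hpost.frame v hlow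
  have hext₂ : Extends M M₂ := hext.trans hpost.ext
  have hinv₂ : ∀ w, w ≠ v → height w ≤ height v → Inv G tot M₂ w := by
    intro w hw hle
    by_cases hwc : height w ≤ height e.child
    · exact hpost.inv w hwc
    · obtain ⟨h₁, h₂⟩ := hpost.frame w (by omega)
      exact (hinv₁ w hw hle).of_extends h₁ h₂ hpost.ext
  have hframe₂ : ∀ w, height v < height w →
      M₂.sorted w = M.sorted w ∧ M₂.choices w = M.choices w := by
    intro w hw
    have hwv : w ≠ v := fun h => by subst h; omega
    obtain ⟨h₁, h₂⟩ := hpost.frame w (by omega)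
    exact ⟨h₁.trans (hsame w hwv).1, h₂.trans (hsame w hwv).2⟩
  have hfound : e.child = G.target ∨ e.rank < (M₂.sorted e.child).size := by
    by_cases ht : e.child = G.target
    · exact Or.inl ht
    · have := hpost.le_size ht
      exact Or.inr (by omega)
  have hsize₂ : (M₂.sorted v).size = min ((M.sorted v).size + 1) (tot v) := by
    rw [hs₂, hsv, Array.size_push]
    omega
  have hcv : M₂.choices v = h' := hc₂.trans (Function.update_self _ _ _)
  have hcost₂ := hpost.cost
  rw [hcost₁, mul_add, mul_one] at hcost₂
  rcases lt_or_ge (e.rank + 1) (tot e.child) with hlt | hge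
  · obtain ⟨e', rfl, he'⟩ := hpost.eq_some hlt
    simp only [wp_bind, wp_lift, wp_readChoices, wp_writeChoices, Timed.add]
    rw [hcv]
    obtain ⟨ha₁, ha₂⟩ :=
      Heap.add_spec ⟨e.child, e.rank + 1, G.weight v e.child + e'.weight⟩ h' hval
    have ha₃ := Heap.add_steps_le ⟨e.child, e.rank + 1, G.weight v e.child + e'.weight⟩ hval
      (n := n) (by omega) (by omega)
    set h₃ := (Heap.add ⟨e.child, e.rank + 1, G.weight v e.child + e'.weight⟩ h').val
    set M₃ : Memory V W := { M₂ with choices := Function.update M₂.choices v h₃ }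
    have hext₃ : Extends M₂ M₃ := Extends.of_sorted_best rfl rfl
    have hsame₃ : ∀ w, w ≠ v → M₃.choices w = M₂.choices w := fun w hw =>
      Function.update_of_ne hw _ _
    have hinv₃ : ∀ w, w ≠ v → height w ≤ height v → Inv G tot M₃ w := fun w hw hle =>
      (hinv₂ w hw hle).of_extends rfl (hsame₃ w hw) hext₃
    have hcv₃ : M₃.choices v = h₃ := Function.update_self _ _ _
    have hN₃ := hN.pop (M' := M₃) hi hmin (hext₂.trans hext₃) (hs₂.trans hsv)
      (by rwa [hcv₃]) hfound (Or.inr ⟨hlt, e', he', by rw [hcv₃, ha₁]⟩)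
      (hinv₃ _ hev hlow.le)
    refine ⟨⟨fun w hw => ?_, hext₂.trans hext₃, fun w hw => ?_, ?_⟩, hsize₂⟩
    · by_cases hwv : w = v
      · subst hwv
        exact ⟨fun h => absurd h hv, fun _ => ⟨_, hN₃⟩⟩
      · exact hinv₃ w hwv hw
    · have hwv : w ≠ v := fun h => by subst h; omega
      exact ⟨(hframe₂ w hw).1, (hsame₃ w hwv).trans (hframe₂ w hw).2⟩
    · rw [found_congr G (show M₃.sorted = M₂.sorted from rfl)]
      generalize popCost n * found G M₂ = X at *
      generalize popCost n * found G M = Y at *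
      simp only [popCost] at hcost₂
      omega
  · obtain rfl := hpost.eq_none hge
    simp only [wp_pure]
    have hN₂ := hN.pop (M' := M₂) hi hmin hext₂ (hs₂.trans hsv) (by rwa [hcv]) hfound
      (Or.inl ⟨hge, by rw [hcv]⟩) (hinv₂ _ hev hlow.le)
    refine ⟨⟨fun w hw => ?_, hext₂, hframe₂, ?_⟩, hsize₂⟩
    · by_cases hwv : w = v
      · subst hwv
        exact ⟨fun h => absurd h hv, fun _ => ⟨_, hN₂⟩⟩
      · exact hinv₂ w hwv hw
    · generalize popCost n * found G M₂ = X at *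
      generalize popCost n * found G M = Y at *
      simp only [popCost] at hcost₂
      omega

theorem Progress.nextPost {k t a : ℕ} (h : Progress G height tot n v M M' t a) (ha : a ≤ 10)
    (hG : SuffixCount G height tot n) (hv : v ≠ G.target)
    (h₁ : min (k + 1) (tot v) ≤ (M'.sorted v).size)
    (h₂ : (M'.sorted v).size ≤ max (M.sorted v).size (k + 1)) :
    NextPost G height tot n v k M (M'.sorted v)[k]? M' t := by
  obtain ⟨c, hN⟩ := (h.inv v le_rfl).2 hv
  have hle := hN.size_le_tot hG hv
  refine ⟨h.mono (by omega), fun hk => ?_, fun hk => ?_, fun _ => h₁, h₂⟩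
  · have hk' : k < (M'.sorted v).size := by omega
    exact ⟨_, Array.getElem?_eq_getElem hk', Array.getElem?_eq_getElem hk'⟩
  · simp only [Array.getElem?_eq_none_iff]
    omega

/-- A call advances at most twice, once for a first visit and once for the request itself. Hence the
condition on `k`, and the allowance 10: four own steps and twice the 3 of `advance`. At the target
rank 0 exists but is not stored, so it must not be requested. The depth suffices because heights
decrease along edges. -/
theorem next_spec [IsOrderedAddMonoid W] (hG : SuffixCount G height tot n) (d : ℕ) (v : V) (k : ℕ)
    (M : Memory V W) (hd : height v < d) (hinv : ∀ w, height w ≤ height v → Inv G tot M w)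
    (ht : v = G.target → 1 ≤ k)
    (hk : v ≠ G.target → k ≤ (M.sorted v).size ∨ ((M.sorted v).size = 0 ∧ k ≤ 1)) :
    wp (next G d v k) M (NextPost G height tot n v k M) := by
  induction d generalizing v k M with
  | zero => omega
  | succ d ih =>
    simp only [next, wp_bind, wp_tick, wp_ite, wp_pure, wp_readSortedSize, wp_readSorted]
    split_ifs with hv h0 h1
    · subst hv
      refine ⟨(Progress.refl hinv 1).mono (by omega), fun h => ?_, fun _ => rfl,
        fun h => absurd rfl h, by omega⟩
      rw [hG.tot_target] at h
      have := ht rfl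
      omega
    · have hadv {M : Memory V W} (hinv : ∀ w, height w ≤ height v → Inv G tot M w) :=
        advance_spec hG (next G d) hv
          (fun u k M hu => ih u k M (by omega)) hinv
      have hpos := hG.tot_pos v
      have hk' : k ≤ 1 := by have := hk hv; omega
      refine wp_mono (hadv hinv) ?_
      rintro _ M₁ t₁ ⟨hp₁, hs₁⟩
      split_ifs with h1
      · refine wp_mono (hadv hp₁.inv) ?_
        rintro _ M₂ t₂ ⟨hp₂, hs₂⟩
        exact ((hp₁.trans hp₂).mono (t' := 1 + (1 + (t₁ + (1 + (t₂ + 1))))) (a' := 10)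
          (by omega)).nextPost le_rfl hG hv (by omega) (by omega)
      · exact (hp₁.mono (t' := 1 + (1 + (t₁ + (1 + 1)))) (a' := 10)
          (by omega)).nextPost le_rfl hG hv (by omega) (by omega)
    · have hk' := hk hv
      refine wp_mono (advance_spec hG (next G d) hv
        (fun u k M hu => ih u k M (by omega)) hinv) ?_
      rintro _ M₁ t₁ ⟨hp₁, hs₁⟩
      exact (hp₁.mono (t' := 1 + (1 + (1 + (t₁ + 1)))) (a' := 10)
        (by omega)).nextPost le_rfl hG hv (by omega) (by omega)
    · have hk' := hk hv
      exact ((Progress.refl hinv 4).mono (t' := 1 + (1 + (1 + 1))) (a' := 10)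
        (by omega)).nextPost le_rfl hG hv (by omega) (by omega)

end AnyKRec

/-! ### Correctness and running time of anyK-rec -/

namespace AnyKRec

variable {V W : Type}

/-- `p` is the path to which the `k`-th suffix of `v` points. -/
inductive Points (G : WeightedDAG V W) (M : Memory V W) : V → ℕ → List V → Prop where
  | target : Points G M G.target 0 [G.target]
  | cons {v : V} {k : ℕ} {e : Suffix V W} {p : List V} (hv : v ≠ G.target)
      (he : (M.sorted v)[k]? = some e) (hp : Points G M e.child e.rank p) : Points G M v k (v :: p)

variable {G : WeightedDAG V W} {M M' : Memory V W}

theorem Points.of_extends {v : V} {k : ℕ} {p : List V} (h : Points G M v k p)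
    (hext : Extends M M') : Points G M' v k p := by
  induction h with
  | target => exact .target
  | cons hv he _ ih => exact .cons hv (hext.getElem? _ _ _ he) ih

theorem Points.unique {v : V} {k : ℕ} {p q : List V} (hp : Points G M v k p)
    (hq : Points G M v k q) : p = q := by
  induction hp generalizing q with
  | target =>
    cases hq with
    | target => rfl
    | cons hv => exact absurd rfl hv
  | cons hv he _ ih =>
    cases hq with
    | target => exact absurd rfl hv
    | cons _ he' hq =>
      rw [he, Option.some.injEq] at he'
      subst he'
      rw [ih hq]

theorem Points.head? {v : V} {k : ℕ} {p : List V} (h : Points G M v k p) : p.head? = some v := by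
  cases h <;> rfl

theorem Points.getLast? {v : V} {k : ℕ} {p : List V} (h : Points G M v k p) :
    p.getLast? = some G.target := by
  induction h with
  | target => rfl
  | cons _ _ _ ih => rw [List.getLast?_cons, ih]; rfl

theorem Points.lt_size {v : V} {k : ℕ} {p : List V} (h : Points G M v k p) (hv : v ≠ G.target) :
    k < (M.sorted v).size := by
  cases h with
  | target => exact absurd rfl hv
  | cons _ he => exact (Array.getElem?_eq_some_iff.1 he).1

theorem HasWeight.unique {u : V} {r : ℕ} {x y : W} (hx : HasWeight M u r x)
    (hy : HasWeight M u r y) : x = y := by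
  rcases hx with ⟨e, he, rfl⟩ | ⟨-, h, hb⟩ <;> rcases hy with ⟨e', he', rfl⟩ | ⟨-, h', hb'⟩
  · rw [he, Option.some.injEq] at he'
    rw [he']
  · simp [h'] at he
  · simp [h] at he'
  · rw [hb] at hb'
    exact Option.some.inj hb'

variable [AddCommMonoid W] [LinearOrder W] {tot height : V → ℕ} {n : ℕ} {v : V}

theorem NodeInv.getElem? {c : V → ℕ} {k : ℕ} {e : Suffix V W} (hN : NodeInv G tot M v c)
    (he : (M.sorted v)[k]? = some e) : e ∈ (M.sorted v).toList ∧ e.child ∈ G.succ v ∧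
      e.rank < tot e.child := by
  have hmem : e ∈ (M.sorted v).toList := by
    rw [← Array.getElem?_toList] at he
    exact List.mem_of_getElem? he
  obtain ⟨h₁, h₂⟩ := (hN.mem_sorted (key e)).1 (List.mem_map_of_mem hmem)
  exact ⟨hmem, h₁, lt_of_lt_of_le h₂ (hN.cursor_le _ h₁)⟩

theorem Points.isChain (hinv : ∀ w, Inv G tot M w) {k : ℕ} {p : List V} (h : Points G M v k p) :
    p.IsChain (fun u v => v ∈ G.succ u) := by
  induction h with
  | target => simp
  | cons hv he hp ih =>
    rw [List.isChain_cons]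
    refine ⟨fun y hy => ?_, ih⟩
    rw [hp.head?, Option.mem_some_iff] at hy
    subst hy
    obtain ⟨c, hN⟩ := (hinv _).2 hv
    exact (hN.getElem? he).2.1

/-- The tail of the path determines the child and, inductively, its rank; no such key is listed
twice. -/
theorem Points.rank_unique (hinv : ∀ w, Inv G tot M w) {i j : ℕ} {p : List V}
    (h : Points G M v i p) (h' : Points G M v j p) : i = j := by
  induction h generalizing j with
  | target =>
    cases h' with
    | target => rfl
    | cons hv => exact absurd rfl hv
  | @cons v i e p hv he hp ih =>
    cases h' with
    | target => exact absurd rfl hv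
    | @cons _ _ e' _ _ he' hp' =>
      have hc : e'.child = e.child := Option.some.inj (hp'.head?.symm.trans hp.head?)
      rw [hc] at hp'
      have hr := ih hp'
      obtain ⟨c, hN⟩ := (hinv v).2 hv
      rw [← Array.getElem?_toList] at he he'
      obtain ⟨h₁, h₂⟩ := List.getElem?_eq_some_iff.1 he
      obtain ⟨h₁', h₂'⟩ := List.getElem?_eq_some_iff.1 he'
      refine (hN.sorted_nodup.getElem_inj_iff (hi := by simpa using h₁)
        (hj := by simpa using h₁')).1 ?_
      rw [List.getElem_map, List.getElem_map, h₂, h₂', key, key, hc, hr]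

theorem Points.hasWeight (hinv : ∀ w, Inv G tot M w) {k : ℕ} {p : List V}
    (h : Points G M v k p) : HasWeight M v k (G.pathWeight p) := by
  induction h with
  | target =>
    obtain ⟨h₁, h₂⟩ := (hinv G.target).1 rfl
    exact Or.inr ⟨rfl, h₁, h₂⟩
  | @cons v k e p hv he hp ih =>
    obtain ⟨c, hN⟩ := (hinv v).2 hv
    obtain ⟨-, x, hx, hxe⟩ := hN.sorted_weight e (hN.getElem? he).1
    refine Or.inl ⟨e, he, ?_⟩
    rw [hxe, hx.unique ih]
    obtain ⟨l, hl⟩ : ∃ l, p = e.child :: l := by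
      have := hp.head?
      cases p with
      | nil => simp at this
      | cons a l => exact ⟨l, by simpa using this⟩
    rw [hl, WeightedDAG.pathWeight]

variable [DecidableEq V]

/-- Fullness passes down the path: a full list at `v` contains every pair `(u, r)` with `r < tot u`.
-/
theorem exists_points (hG : SuffixCount G height tot n) (hinv : ∀ w, Inv G tot M w)
    (p : List V) (v : V) (hlast : (v :: p).getLast? = some G.target)
    (hp : (v :: p).IsChain (fun u v => v ∈ G.succ u))
    (hfull : v ≠ G.target → tot v ≤ (M.sorted v).size) : ∃ k, Points G M v k (v :: p) := by
  induction p generalizing v with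
  | nil =>
    obtain rfl : v = G.target := by simpa using hlast
    exact ⟨0, .target⟩
  | cons u p ih =>
    rw [List.isChain_cons_cons] at hp
    have hv : v ≠ G.target := by
      rintro rfl
      rw [G.succ_target] at hp
      simp at hp
    obtain ⟨c, hN⟩ := (hinv v).2 hv
    have hc := (hN.tot_le_size_iff hG hv).1 (hfull hv) u hp.1
    have hmem (r : ℕ) (hr : r < tot u) : ∃ (k : ℕ) (e : Suffix V W), (M.sorted v)[k]? = some e ∧ e.child = u ∧
        e.rank = r ∧ e ∈ (M.sorted v).toList := by
      obtain ⟨e, he, hk⟩ := List.mem_map.1 ((hN.mem_sorted ⟨u, r⟩).2 ⟨hp.1, by simpa [hc]⟩)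
      obtain ⟨k, hk'⟩ := List.mem_iff_getElem?.1 he
      simp only [key, Sigma.mk.injEq, heq_eq_eq] at hk
      exact ⟨k, e, by rw [← hk', Array.getElem?_toList], hk.1, hk.2, he⟩
    -- The listed pointer to the last rank `tot u - 1` forces the list of `u` to be full as well.
    obtain ⟨r, hr⟩ := ih u (by rwa [List.getLast?_cons_cons] at hlast) hp.2 fun hu => by
      have hpos := hG.tot_pos u
      obtain ⟨k, e, -, rfl, he, hm⟩ := hmem (tot u - 1) (by omega)
      have := (hN.sorted_weight e hm).1.resolve_left hu
      omega
    have hrt : r < tot u := by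
      by_cases hu : u = G.target
      · subst hu
        cases hr with
        | target => exact hG.tot_pos _
        | cons hu => exact absurd rfl hu
      · obtain ⟨c', hN'⟩ := (hinv u).2 hu
        exact (hr.lt_size hu).trans_le (hN'.size_le_tot hG hu)
    obtain ⟨k, e, he, rfl, rfl, -⟩ := hmem r hrt
    exact ⟨k, .cons hv he hr⟩

theorem isRankedEnumeration_of_points (hG : SuffixCount G height tot n)
    (hinv : ∀ w, Inv G tot M w) (hst : G.source ≠ G.target) {L : List (List V)}
    (hlen : L.length = tot G.source) (hfull : tot G.source ≤ (M.sorted G.source).size)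
    (hL : ∀ i p, L[i]? = some p → Points G M G.source i p) : G.IsRankedEnumeration L := by
  obtain ⟨c, hN⟩ := (hinv _).2 hst
  have hL' (i : ℕ) (hi : i < L.length) : Points G M G.source i L[i] :=
    hL i _ (List.getElem?_eq_getElem hi)
  refine ⟨?_, fun p => ⟨fun hp => ?_, fun hp => ?_⟩, ?_⟩
  · refine List.pairwise_iff_getElem.2 fun i j hi hj hij heq => ?_
    have := (hL' i hi).rank_unique hinv (heq ▸ hL' j hj)
    omega
  · obtain ⟨i, hi⟩ := List.mem_iff_getElem?.1 hp
    have := hL i p hi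
    exact ⟨this.head?, this.getLast?, this.isChain hinv⟩
  · obtain ⟨h₁, h₂, h₃⟩ := hp
    match p, h₁ with
    | _ :: p, rfl =>
      obtain ⟨k, hk⟩ := exists_points hG hinv p G.source h₂ h₃ fun _ => hfull
      have hlt : k < L.length := by
        rw [hlen]
        exact (hk.lt_size hst).trans_le (hN.size_le_tot hG hst)
      rw [hk.unique (hL' k hlt)]
      exact List.getElem_mem hlt
  · refine List.pairwise_iff_getElem.2 fun i j hi hj hij => ?_
    have hw (i : ℕ) (hi : i < L.length) : ∃ h : i < (M.sorted G.source).toList.length,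
        ((M.sorted G.source).toList[i]).weight = G.pathWeight L[i] := by
      rcases (hL' i hi).hasWeight hinv with ⟨e, he, hw⟩ | ⟨-, h, -⟩
      · rw [← Array.getElem?_toList] at he
        obtain ⟨h₁, rfl⟩ := List.getElem?_eq_some_iff.1 he
        exact ⟨h₁, hw⟩
      · have := hG.tot_pos G.source
        simp [h] at hfull
        omega
    obtain ⟨h₁, hw₁⟩ := hw i hi
    obtain ⟨h₂, hw₂⟩ := hw j hj
    rw [← hw₁, ← hw₂]
    exact List.pairwise_iff_getElem.1 hN.pairwise i j h₁ h₂ hij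

theorem assemble_spec (hG : SuffixCount G height tot n) (hinv : ∀ w, Inv G tot M w) (d : ℕ) (v : V)
    (k : ℕ) (hd : height v < d) (ht : v = G.target → k = 0)
    (hk : v ≠ G.target → k < (M.sorted v).size) :
    wp (assemble G d v k) M fun p M' t => M' = M ∧ Points G M v k p ∧ t ≤ 2 * height v + 1 := by
  induction d generalizing v k with
  | zero => omega
  | succ d ih =>
    simp only [assemble, wp_bind, wp_tick, wp_ite, wp_pure, wp_readSorted]
    split_ifs with hv
    · subst hv
      obtain rfl := ht rfl
      exact ⟨trivial, .target, by omega⟩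
    · have he := Array.getElem?_eq_getElem (hk hv)
      generalize (M.sorted v)[k]'(hk hv) = e at he
      simp only [he, wp_bind, wp_pure]
      obtain ⟨c, hN⟩ := (hinv v).2 hv
      obtain ⟨h₁, h₂, h₃⟩ := hN.getElem? he
      have hlow := hG.height_lt v _ h₂
      refine wp_mono (ih e.child e.rank (by omega) (fun h => ?_) fun h =>
        (hN.sorted_weight e h₁).1.resolve_left h) ?_
      · rw [h, hG.tot_target] at h₃
        omega
      · rintro p _ t ⟨rfl, hp, ht⟩
        exact ⟨rfl, .cons hv he hp, by omega⟩

/-- Per solution, 2 steps go to the loop, 10 to the allowance of `next` and `2 * height + 1` to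
writing the path. The constant 2 pays for the final test that finds the queue empty. -/
theorem loop_spec [IsOrderedAddMonoid W] (hG : SuffixCount G height tot n)
    (hst : G.source ≠ G.target) (hd : height G.source < G.nodes.length) (r k : ℕ)
    (hinv : ∀ w, Inv G tot M w) (hk : (M.sorted G.source).size = k)
    (hr : tot G.source ≤ k + r) :
    wp (loop G r k) M fun L M' t => (∀ w, Inv G tot M' w) ∧ Extends M M' ∧
      tot G.source ≤ (M'.sorted G.source).size ∧ k + L.length = tot G.source ∧
      (∀ i p, L[i]? = some p → Points G M' G.source (k + i) p) ∧
      t + popCost n * found G M ≤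
        2 + (2 * height G.source + 13) * L.length + popCost n * found G M' := by
  induction r generalizing M k with
  | zero =>
    obtain ⟨c, hN⟩ := (hinv _).2 hst
    have := hN.size_le_tot hG hst
    simp only [loop, wp_bind, wp_tick, wp_pure]
    refine ⟨hinv, .refl _, by omega, ?_, by simp, by omega⟩
    simp only [List.length_nil]
    omega
  | succ r ih =>
    obtain ⟨c, hN⟩ := (hinv _).2 hst
    have hle := hN.size_le_tot hG hst
    simp only [loop, wp_bind, wp_tick, wp_ite, wp_pure, wp_readChoices]
    split_ifs with he
    · have : M.choices G.source = .nil := by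
        cases h : M.choices G.source with
        | nil => rfl
        | node => simp [h, Heap.isEmpty] at he
      rw [hN.choices_eq_nil_iff hG hst] at this
      refine ⟨hinv, .refl _, by omega, ?_, by simp, by omega⟩
      simp only [List.length_nil]
      omega
    have hlt : k < tot G.source := by
      refine lt_of_le_of_ne (hk ▸ hle) fun h => ?_
      rw [(hN.choices_eq_nil_iff hG hst).2 (hk.trans h)] at he
      simp [Heap.isEmpty] at he
    refine wp_mono (next_spec hG _ G.source k M hd (fun w _ => hinv w) (fun h => absurd h hst)
      fun _ => by omega) ?_
    intro o M₁ t₁ h₁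
    have hinv₁ : ∀ w, Inv G tot M₁ w := by
      intro w
      by_cases hw : height w ≤ height G.source
      · exact h₁.inv w hw
      · obtain ⟨h, h'⟩ := h₁.frame w (by omega)
        exact (hinv w).of_extends h h' h₁.ext
    have hs₁ := h₁.le_size hst
    have hs₂ := h₁.size_le
    refine wp_mono (assemble_spec hG hinv₁ _ G.source k hd (fun h => absurd h hst)
      fun _ => by omega) ?_
    rintro p _ t₂ ⟨rfl, hp, ht₂⟩
    refine wp_mono (ih (k + 1) hinv₁ (by omega) (by omega)) ?_
    rintro L M₂ t₃ ⟨g₁, g₂, g₃, g₄, g₅, g₆⟩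
    refine ⟨g₁, h₁.ext.trans g₂, g₃, by simp only [List.length_cons]; omega, ?_, ?_⟩
    · rintro (_ | i) q hq
      · rw [List.getElem?_cons_zero, Option.some.injEq] at hq
        exact hq ▸ hp.of_extends g₂
      · rw [List.getElem?_cons_succ] at hq
        have := g₅ i q hq
        rwa [add_assoc, add_comm 1 i] at this
    · have hc := h₁.cost
      simp only [List.length_cons, mul_add, mul_one]
      omega

end AnyKRec

/-! ### Total cost of anyK-rec on a DAG with known suffix counts. -/

open AnyKRec

theorem anyKRec_spec {V W : Type} [DecidableEq V] [AddCommMonoid W] [LinearOrder W]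
    [IsOrderedAddMonoid W] {G : WeightedDAG V W} {height tot : V → ℕ} {n : ℕ}
    (hG : SuffixCount G height tot n) (hst : G.source ≠ G.target)
    (hd : height G.source < G.nodes.length) (k : ℕ) (hk : tot G.source ≤ k) :
    G.IsRankedEnumeration (anyKRec G k).val ∧
      (anyKRec G k).steps ≤ 3 + (G.nodes.map (dpCost G n)).sum +
        (2 * height G.source + 13) * tot G.source + popCost n * (G.nodes.map tot).sum := by
  have hspec : wp (do AnyKRec.dp G G.nodes; AnyKRec.loop G k 0)
      (⟨fun _ => none, fun _ => .nil, fun _ => #[]⟩ : Memory V W) fun L M t =>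
      G.IsRankedEnumeration L ∧ t ≤ 3 + (G.nodes.map (dpCost G n)).sum +
        (2 * height G.source + 13) * tot G.source + popCost n * (G.nodes.map tot).sum := by
    rw [wp_bind]
    refine wp_mono (dp_spec hG [] G.nodes (by simp) (fun _ => rfl) (by simp) (by simp)) ?_
    rintro _ M t ⟨hs, hinv, ht⟩
    refine wp_mono (loop_spec hG hst hd k 0 hinv (by simp [hs]) (by omega)) ?_
    rintro L M' t' ⟨hinv', -, hfull, hlen, hL, ht'⟩
    rw [zero_add] at hlen
    refine ⟨isRankedEnumeration_of_points hG hinv' hst hlen hfull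
      fun i p hp => by simpa using hL i p hp, ?_⟩
    have hfound : found G M' ≤ (G.nodes.map tot).sum := by
      refine List.sum_le_sum fun v _ => ?_
      by_cases hv : v = G.target
      · simp [((hinv' v).1 hv).1]
      · obtain ⟨c, hN⟩ := (hinv' v).2 hv
        exact hN.size_le_tot hG hv
    have := Nat.mul_le_mul_left (popCost n) hfound
    rw [hlen] at ht'
    omega
  exact hspec

/-! ### Cartesian products -/

section

variable {n ℓ : ℕ}

namespace CPNode

/-- The number of edges on each path from a node to the target. -/
def height : CPNode n ℓ → ℕ
  | source => ℓ + 1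
  | tuple i _ => ℓ - i
  | target => 0

/-- The number of paths from a node to the target. -/
def numSuffixes : CPNode n ℓ → ℕ
  | source => n ^ ℓ
  | tuple i _ => n ^ (ℓ - 1 - i)
  | target => 1

theorem sum_map_nodes (f : CPNode n ℓ → ℕ) : ((nodes n ℓ).map f).sum =
    f target + ∑ i, ∑ j, f (tuple i j) + f source := by
  have h : ((List.finRange ℓ).map fun i => ((List.finRange n).map fun j => f (tuple i j)).sum).sum =
      ∑ i, ∑ j, f (tuple i j) := by
    simp only [← List.ofFn_eq_map, List.sum_ofFn]
  rw [← h]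
  simp only [nodes, List.map_append, List.map_cons, List.map_flatMap, List.map_map, List.sum_append,
    List.sum_cons, List.map_nil, List.sum_nil, add_zero]
  simp only [List.flatMap_def, List.sum_flatten, List.map_reverse, List.sum_reverse, List.map_map,
    Function.comp_def]

theorem length_nodes : (nodes n ℓ).length = ℓ * n + 2 := by
  have := sum_map_nodes (fun _ : CPNode n ℓ => 1)
  simp only [List.map_const', List.sum_replicate, smul_eq_mul, mul_one, Finset.sum_const,
    Finset.card_univ, Fintype.card_fin] at this
  omega

theorem sum_stage (i : ℕ) :
    ∑ u ∈ (stage n ℓ i).toFinset, numSuffixes u = n ^ (ℓ - i) := by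
  unfold stage
  split
  · rename_i h
    rw [List.sum_toFinset _ ((List.nodup_finRange n).map fun a b h => by simpa using h),
      List.map_map]
    simp only [Function.comp_def, numSuffixes, List.map_const', List.sum_replicate, smul_eq_mul,
      List.length_finRange]
    rw [← pow_succ']
    congr 1
    omega
  · rename_i h
    simp [numSuffixes, show ℓ - i = 0 by omega]

theorem length_stage (i : ℕ) : (stage n ℓ i).length = if i < ℓ then n else 1 := by
  unfold stage
  split <;> simp

end CPNode

open CPNode

theorem cartesianDAG_suffixCount (hn : 1 ≤ n) (w : Fin ℓ → Fin n → ℝ) :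
    AnyKRec.SuffixCount (cartesianDAG n ℓ w) height numSuffixes n where
  height_lt v u hu := by
    change u ∈ succ v at hu
    cases v with
    | target => simp [succ] at hu
    | source =>
      cases u with
      | source => exact absurd hu (source_not_mem_succ _)
      | target => simp [height]
      | tuple i j =>
        simp only [height]
        omega
    | tuple i j =>
      cases u with
      | source => exact absurd hu (source_not_mem_succ _)
      | target =>
        simp only [height]
        omega
      | tuple i' j' =>
        have := tuple_mem_succ_tuple hu
        simp only [height]
        omega
  tot_target := rfl
  tot_eq v hv := by
    change _ = ∑ u ∈ (succ v).toFinset, numSuffixes u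
    cases v with
    | target => exact absurd rfl hv
    | source => exact (sum_stage 0).symm
    | tuple i j =>
      refine Eq.trans ?_ (sum_stage (i + 1)).symm
      simp only [numSuffixes]
      congr 1
      omega
  tot_pos v := by
    cases v <;> simp only [numSuffixes] <;> positivity
  length_succ_le v := by
    change (succ v).length ≤ n
    cases v with
    | target => simp [succ]
    | source =>
      rw [succ, length_stage]
      split <;> omega
    | tuple i j =>
      rw [succ, length_stage]
      split <;> omega

/-- For `n ≥ 2` the geometric series leaves at most `4 * n ^ ℓ` suffixes in all. The term `84 * ℓ`
is there for `n = 1`, where the sum is `ℓ + 2`. -/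
theorem sum_numSuffixes_mul_popCost_le (hn : 1 ≤ n) (hℓ : 1 ≤ ℓ) :
    AnyKRec.popCost n * ((nodes n ℓ).map numSuffixes).sum ≤
      n ^ ℓ * (32 * Nat.log 2 (n + 1) + 80 + 84 * ℓ) := by
  have hsum : ((nodes n ℓ).map numSuffixes).sum =
      1 + ∑ i ∈ Finset.range ℓ, n ^ (i + 1) + n ^ ℓ := by
    rw [sum_map_nodes]
    simp only [numSuffixes, Finset.sum_const, Finset.card_univ, Fintype.card_fin, smul_eq_mul]
    rw [Fin.sum_univ_eq_sum_range (fun i => n * n ^ (ℓ - 1 - i)), ← Finset.sum_range_reflect]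
    congr 2
    refine Finset.sum_congr rfl fun i hi => ?_
    rw [← pow_succ']
    congr 1
    have := Finset.mem_range.1 hi
    omega
  rw [hsum]
  rcases hn.eq_or_lt with rfl | hn
  · have : Nat.log 2 2 = 1 := Nat.log_pow one_lt_two 1
    simp [AnyKRec.popCost, this]
    omega
  · have hgeom : ∀ m, ∑ i ∈ Finset.range m, n ^ (i + 1) ≤ 2 * n ^ m := by
      intro m
      induction m with
      | zero => simp
      | succ m ih =>
        rw [Finset.sum_range_succ, pow_succ]
        have := Nat.mul_le_mul_left (n ^ m) hn
        omega
    have h1 : 1 ≤ n ^ ℓ := Nat.one_le_pow _ _ (by omega)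
    have h2 := hgeom ℓ
    have h3 : 1 + ∑ i ∈ Finset.range ℓ, n ^ (i + 1) + n ^ ℓ ≤ 4 * n ^ ℓ := by omega
    refine (Nat.mul_le_mul_left _ h3).trans ?_
    rw [AnyKRec.popCost]
    nlinarith [Nat.zero_le (n ^ ℓ * ℓ)]

theorem sum_dpCost_le (hn : 1 ≤ n) (hℓ : 1 ≤ ℓ) (w : Fin ℓ → Fin n → ℝ) :
    ((nodes n ℓ).map (AnyKRec.dpCost (cartesianDAG n ℓ w) n)).sum ≤
      n ^ ℓ * (24 * Nat.log 2 (n + 1) + 21 + 36 * ℓ) := by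
  obtain ⟨m, rfl⟩ : ∃ m, ℓ = m + 1 := ⟨ℓ - 1, by omega⟩
  set L := Nat.log 2 (n + 1)
  have hL : L ≤ n := Nat.lt_succ_iff.1 (Nat.log_lt_of_lt_pow (by omega) Nat.lt_two_pow_self)
  have hpow : n ≤ n ^ (m + 1) := Nat.le_self_pow (by omega) n
  have hsum : ((nodes n (m + 1)).map (AnyKRec.dpCost (cartesianDAG n (m + 1) w) n)).sum =
      (2 * n + m * (n * n)) * (8 * L + 7) + 7 * ((m + 1) * n + 2) := by
    rw [sum_map_nodes]
    have hs (v : CPNode n (m + 1)) : (cartesianDAG n (m + 1) w).succ v = succ v := rfl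
    simp only [AnyKRec.dpCost, hs, succ, length_stage, Finset.sum_const, Finset.card_univ,
      Fintype.card_fin, smul_eq_mul, Fin.sum_univ_castSucc, Fin.val_castSucc, Fin.val_last,
      add_lt_add_iff_right, Fin.is_lt, if_true, lt_irrefl, if_false, List.length_nil,
      Nat.zero_lt_succ]
    ring
  -- The edges between inner stages. The factors `m` and `L` must not multiply: for `m ≤ 1` there is
  -- no growing factor `m`, and for `m ≥ 2` a spare factor `n` of `n ^ (m + 1)` absorbs `8 * L + 7 ≤
  -- 15 * n`.
  have h₁ : m * (n * n) * (8 * L + 7) ≤ n ^ (m + 1) * (8 * L + 7 + 15 * (m + 1)) := by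
    match m with
    | 0 => simp
    | 1 =>
      rw [one_mul, ← pow_two]
      exact Nat.mul_le_mul_left _ (by omega)
    | m + 2 =>
      have h3 : n * n * n ≤ n ^ (m + 2 + 1) := by
        calc n * n * n = n ^ 3 := by ring
          _ ≤ _ := Nat.pow_le_pow_right hn (by omega)
      calc (m + 2) * (n * n) * (8 * L + 7) ≤ (m + 2) * (n * n) * (15 * n) :=
            Nat.mul_le_mul_left _ (by omega)
        _ = n * n * n * (15 * (m + 2)) := by ring
        _ ≤ n ^ (m + 2 + 1) * (8 * L + 7 + 15 * (m + 2 + 1)) := Nat.mul_le_mul h3 (by omega)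
  have h₂ : 2 * n * (8 * L + 7) ≤ n ^ (m + 1) * (2 * (8 * L + 7)) := by
    rw [mul_comm 2 n, mul_assoc]
    exact Nat.mul_le_mul_right _ hpow
  have h₃ : 7 * ((m + 1) * n + 2) ≤ n ^ (m + 1) * (21 * (m + 1)) := by
    calc 7 * ((m + 1) * n + 2) ≤ n * (21 * (m + 1)) := by nlinarith
      _ ≤ _ := Nat.mul_le_mul_right _ hpow
  rw [hsum, add_mul]
  calc _ ≤ n ^ (m + 1) * (2 * (8 * L + 7)) + n ^ (m + 1) * (8 * L + 7 + 15 * (m + 1)) +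
        n ^ (m + 1) * (21 * (m + 1)) := by omega
    _ = _ := by ring

theorem natLog_succ_le (hn : 1 ≤ n) : (Nat.log 2 (n + 1) : ℝ) ≤ 2 * Real.log n + 1 := by
  have hn' : (1 : ℝ) ≤ n := by exact_mod_cast hn
  have h := Real.natLog_le_logb (n + 1) 2
  have h2 := Real.log_two_gt_d9
  have h3 : Real.log ((n : ℝ) + 1) ≤ Real.log 2 + Real.log n := by
    rw [← Real.log_mul two_ne_zero (by positivity)]
    exact Real.log_le_log (by positivity) (by linarith)
  have h4 := Real.log_nonneg hn'
  push_cast at h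
  refine h.trans ?_
  rw [Real.logb, div_le_iff₀ (by linarith)]
  nlinarith

theorem anyKRec_cartesianDAG (hn : 1 ≤ n) (hℓ : 1 ≤ ℓ) (w : Fin ℓ → Fin n → ℝ) (k : ℕ)
    (hk : n ^ ℓ ≤ k) :
    (cartesianDAG n ℓ w).IsRankedEnumeration (anyKRec (cartesianDAG n ℓ w) k).val ∧
      ((anyKRec (cartesianDAG n ℓ w) k).steps : ℝ) ≤ 300 * ((n : ℝ) ^ ℓ * (Real.log n + ℓ)) := by
  have hd : height (cartesianDAG n ℓ w).source < (cartesianDAG n ℓ w).nodes.length := by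
    change ℓ + 1 < (nodes n ℓ).length
    rw [length_nodes]
    nlinarith
  obtain ⟨h₁, h₂⟩ := anyKRec_spec (cartesianDAG_suffixCount hn w) (by simp [cartesianDAG]) hd k hk
  refine ⟨h₁, ?_⟩
  have h₃ := sum_numSuffixes_mul_popCost_le hn hℓ
  have h₄ := sum_dpCost_le hn hℓ w
  have h1 : 1 ≤ n ^ ℓ := Nat.one_le_pow _ _ (by omega)
  have h₅ : (anyKRec (cartesianDAG n ℓ w) k).steps ≤
      n ^ ℓ * (56 * Nat.log 2 (n + 1) + 119 + 122 * ℓ) := by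
    refine h₂.trans ?_
    change 3 + ((nodes n ℓ).map (AnyKRec.dpCost (cartesianDAG n ℓ w) n)).sum +
      (2 * (ℓ + 1) + 13) * n ^ ℓ + AnyKRec.popCost n * ((nodes n ℓ).map numSuffixes).sum ≤ _
    nlinarith
  have h₆ := natLog_succ_le hn
  have hℓ' : (1 : ℝ) ≤ ℓ := by exact_mod_cast hℓ
  have h₇ := Real.log_nonneg (show (1 : ℝ) ≤ n by exact_mod_cast hn)
  calc ((anyKRec (cartesianDAG n ℓ w) k).steps : ℝ)
      ≤ (n : ℝ) ^ ℓ * (56 * Nat.log 2 (n + 1) + 119 + 122 * ℓ) := by exact_mod_cast h₅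
    _ ≤ (n : ℝ) ^ ℓ * (300 * (Real.log n + ℓ)) := by
        -- `natLog_succ_le` bounds the bracket by `112 log n + 175 + 122 ℓ`, and `175 ≤ 175 ℓ`.
        gcongr
        linarith
    _ = _ := by ring

end

/-! ### The comparison of anyK-rec with Batch. -/

theorem mainTheorem4 :
    ∃ C c : ℝ, 0 < C ∧ 0 < c ∧
      -- anyK-rec solves the problem in time `O(n ^ ℓ * (log n + ℓ))` on every Cartesian product
      (∀ (n ℓ : ℕ), 1 ≤ n → 1 ≤ ℓ → ∀ (w : Fin ℓ → Fin n → ℝ) (k : ℕ), n ^ ℓ ≤ k →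
        (cartesianDAG n ℓ w).IsRankedEnumeration (anyKRec (cartesianDAG n ℓ w) k).val ∧
        ((anyKRec (cartesianDAG n ℓ w) k).steps : ℝ) ≤
          C * ((n : ℝ) ^ ℓ * (Real.log n + ℓ))) ∧
      -- there are `n ^ ℓ` solutions, and for suitable weights no two of them are tied
      (∀ (n ℓ : ℕ), 1 ≤ n → 1 ≤ ℓ →
        (∀ w : Fin ℓ → Fin n → ℝ, Nat.card (cartesianDAG n ℓ w).Solution = n ^ ℓ) ∧
        ∃ w : Fin ℓ → Fin n → ℝ,
          Function.Injective fun p : (cartesianDAG n ℓ w).Solution =>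
            (cartesianDAG n ℓ w).pathWeight p.val) ∧
      -- Batch needs time `Ω(n ^ ℓ * ℓ * log n)` on each input without ties, whatever its sort is,
      -- in the mean (hence also in the worst case) over the order of the unsorted solutions
      (∀ (n ℓ : ℕ), 1 ≤ n → 1 ≤ ℓ → ∀ w : Fin ℓ → Fin n → ℝ,
        (Function.Injective fun p : (cartesianDAG n ℓ w).Solution =>
          (cartesianDAG n ℓ w).pathWeight p.val) →
        ∀ (enum : Fin (n ^ ℓ) ≃ (cartesianDAG n ℓ w).Solution) (A : ComparisonSort (n ^ ℓ)),
          c * ((n : ℝ) ^ ℓ * (ℓ * Real.log n)) ≤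
            meanBatchTime enum A fun p => (cartesianDAG n ℓ w).pathWeight p.val) ∧
      -- also for each fixed order of enumeration, in the worst case over the rankings
      (∀ (n ℓ : ℕ), 1 ≤ n → 1 ≤ ℓ → ∀ w : Fin ℓ → Fin n → ℝ,
        ∀ (enum : Fin (n ^ ℓ) ≃ (cartesianDAG n ℓ w).Solution) (A : ComparisonSort (n ^ ℓ)),
          ∃ rank : (cartesianDAG n ℓ w).Solution → ℝ, Function.Injective rank ∧
            c * ((n : ℝ) ^ ℓ * (ℓ * Real.log n)) ≤ (batchTime enum A rank : ℝ)) ∧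
      -- on the same inputs, the time of anyK-rec is asymptotically lower than that of any Batch
      (∀ ε : ℝ, 0 < ε → ∃ m : ℕ, ∀ n ℓ : ℕ, m ≤ n → m ≤ ℓ → ∀ w : Fin ℓ → Fin n → ℝ,
        (Function.Injective fun p : (cartesianDAG n ℓ w).Solution =>
          (cartesianDAG n ℓ w).pathWeight p.val) →
        ∀ (enum : Fin (n ^ ℓ) ≃ (cartesianDAG n ℓ w).Solution) (A : ComparisonSort (n ^ ℓ))
          (k : ℕ), n ^ ℓ ≤ k →
          ((anyKRec (cartesianDAG n ℓ w) k).steps : ℝ) ≤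
            ε * meanBatchTime enum A fun p => (cartesianDAG n ℓ w).pathWeight p.val) := by
  have hN (n ℓ : ℕ) : ((n ^ ℓ : ℕ) : ℝ) * Real.log (n ^ ℓ : ℕ) =
      (n : ℝ) ^ ℓ * (ℓ * Real.log n) := by
    rw [Nat.cast_pow, Real.log_pow]
  refine ⟨300, 1, by norm_num, by norm_num, fun n ℓ hn hℓ w k hk => anyKRec_cartesianDAG hn hℓ w k hk,
    fun n ℓ hn _ => ⟨fun w => card_solution hn w, exists_injective_pathWeight hn⟩,
    fun n ℓ _ _ w hw enum A => ?_, fun n ℓ _ _ w enum A => ?_, fun ε hε => ?_⟩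
  · rw [one_mul, ← hN]
    exact mul_log_le_meanBatchTime enum A _ hw
  · rw [one_mul, ← hN]
    exact exists_mul_log_le_batchTime enum A
  · have hlog : Filter.Tendsto (fun n : ℕ => Real.log n) Filter.atTop Filter.atTop :=
      Real.tendsto_log_atTop.comp tendsto_natCast_atTop_atTop
    -- If `log n` and `ℓ` are both at least `600 / ε`, then `300 log n` and `300 ℓ` are each at most
    -- half of `ε * ℓ * log n`.
    obtain ⟨m₁, hm₁⟩ := Filter.eventually_atTop.1 (hlog.eventually_ge_atTop (600 / ε))
    obtain ⟨m₂, hm₂⟩ := exists_nat_ge (600 / ε)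
    refine ⟨max 1 (max m₁ m₂), fun n ℓ hn hℓ w hw enum A k hk => ?_⟩
    simp only [max_le_iff] at hn hℓ
    refine (anyKRec_cartesianDAG hn.1 hℓ.1 w k hk).2.trans (le_trans ?_
      (mul_le_mul_of_nonneg_left (mul_log_le_meanBatchTime enum A _ hw) hε.le))
    rw [hN]
    have h₁ := hm₁ n hn.2.1
    have h₂ : 600 / ε ≤ ℓ := hm₂.trans (by exact_mod_cast hℓ.2.2)
    rw [div_le_iff₀ hε] at h₁ h₂
    have h₃ : 300 * (Real.log n + ℓ) ≤ ε * (ℓ * Real.log n) := by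
      have hℓ' : (0 : ℝ) ≤ ℓ := Nat.cast_nonneg ℓ
      have h₄ := Real.log_nonneg (show (1 : ℝ) ≤ n by exact_mod_cast hn.1)
      nlinarith [mul_le_mul_of_nonneg_left h₁ hℓ', mul_le_mul_of_nonneg_left h₂ h₄]
    calc 300 * ((n : ℝ) ^ ℓ * (Real.log n + ℓ)) = (n : ℝ) ^ ℓ * (300 * (Real.log n + ℓ)) := by ring
      _ ≤ (n : ℝ) ^ ℓ * (ε * (ℓ * Real.log n)) := by gcongr
      _ = _ := by ring
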